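/- Let $a\in\mathbb R^d$, $z\ge 0$ and let $r$ be a probability measure on $\mathbb R^d\setminus\{0\}$ with compact support (as a measure on $\mathbb R^d$). For $\mu>0$ let $\Phi_t$, $t>0$, be the continuous probability densities on $\mathbb R^d$ of the jump-diffusion (Lévy) process started at $0$ with drift $a$, diffusion constant $\mu$, jump frequency $z$ and jump distribution $r$; that is, the solution, among families of continuous probability densities and in the sense of tempered distributions, of $$\frac{\partial\Phi_t}{\partial t}(\phi)=\mu\,\Delta\Phi_t(\phi)-\sum_{X=1}^d a_X\frac{\partial\Phi_t}{\partial\phi_X}(\phi)+z\int[\Phi_t(\phi-y)-\Phi_t(\phi)]\,dr(y),\qquad \Phi_t\to\delta_0\ \ (t\searrow 0).$$ (Such a solution exists for every $\mu>0$.) Let $\Psi^{\rm jump}(\eta)=\langle a,\eta\rangle+z\int(e^{\langle y,\eta\rangle}-1)\,dr(y)$ and $$C_{X_1\cdots X_n}=\frac{\partial^n\Psi^{\rm jump}}{\partial\eta_{X_1}\cdots\partial\eta_{X_n}}(0).$$ Let $\bar Q(m)$ be the finite set of graphs with $m$ numbered directed edges (loops and multiple edges allowed) and two types of vertices, "inner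 empty" and "outer empty"; vertices of the same type are indistinguishable, every vertex is hit by at least one edge end, and each outer empty vertex is hit by exactly one edge end. For $t>0$, $\phi\in\mathbb R^d$ and $G\in\bar Q(m)$ the value $\mathcal V[G](t,\phi)$ is obtained as follows: assign an index $X_j\in\{1,\dots,d\}$ to each edge $j=1,\dots,m$; multiply by $-\phi_{X_j}$ for each outer empty vertex, $j$ being the edge that hits it, and by $t\,C_{X_{j_1}\cdots X_{j_l}}$ for each inner empty vertex, $j_1,\dots,j_l$ being the edges that hit it (the index of a loop is repeated twice); then sum over all $X_1,\dots,X_m\in\{1,\dots,d\}$. For $\sigma>0$ let $S_\sigma=\{\tau\in\mathbb C:\operatorname{dist}(\tau,[0,\infty))<1/\sigma\}$. Then, for all $t>0$ and $\phi\in\mathbb R^d$: 1. There is $\sigma=\sigma(t,\phi)>0$, not depending on $\mu$, such that the series $$\sum_{m=0}^\infty\frac{(-\tau)^m}{(m!)^2}\sum_{G\in\bar Q(m)}\mathcal V[G](t,\phi)$$ converges for $|\tau|<1/\sigma$ and its sum has an analytic continuation to $S_\sigma$. 2. If $\sigma>0$ and $B(\tau,t,\phi)$ is an analytic continuation of the sum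 of this series (near $\tau=0$) to $S_\sigma$, then for every $\mu>0$, with $\beta=1/(4\mu t)$, the following integral converges absolutely and $$\Phi_t(\phi)=\pi^{-d/2}\,\beta^{d/2-1}\int_0^\infty e^{-\tau/\beta}\,B(\tau,t,\phi)\,d\tau .$$ -/

import Mathlib

open MeasureTheory Set Filter Topology
open scoped SchwartzMap Laplacian

namespace LevyBorel

noncomputable section

/-- `ℝ^d` with its Euclidean norm. -/
abbrev Space (d : ℕ) : Type := EuclideanSpace ℝ (Fin d)

/-- The symbol `Ψ^jump(η) = ⟨a, η⟩ + z ∫ (exp ⟨y, η⟩ - 1) dr(y)` of the generator with the diffusive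
part removed (`a` drift, `z` jump frequency, `r` jump distribution). At `η = iξ` it is the
Lévy-Khinchine exponent `i⟨a, ξ⟩ + z ∫ (exp (i⟨y, ξ⟩) - 1) dr(y)`. -/
def jumpSymbol {d : ℕ} (a : Space d) (z : ℝ) (r : Measure (Space d)) (η : Space d) : ℝ :=
  inner ℝ a η + z * ∫ y, (Real.exp (inner ℝ y η) - 1) ∂r

/-- The coefficient `C^{(n)}_{X_1 … X_n} = ∂^n Ψ^jump / ∂η_{X_1} ⋯ ∂η_{X_n} (0)` of the symbol. -/
def coeffC {d : ℕ} (a : Space d) (z : ℝ) (r : Measure (Space d)) {n : ℕ} (X : Fin n → Fin d) : ℝ :=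
  iteratedFDeriv ℝ n (jumpSymbol a z r) 0 (fun i => EuclideanSpace.single (X i) 1)

/-- The two legs of each of `m` directed edges: `(j, 0)` is the tail and `(j, 1)` the head of the
`j`-th edge. -/
abbrev Leg (m : ℕ) : Type := Fin m × Fin 2

/-- A graph with `m` directed (and numbered) edges and two types of vertices, inner empty and outer
empty, such that every outer empty vertex is hit by exactly one edge. Vertices of the same type are
indistinguishable and every vertex is hit by at least one edge; so a vertex is
recorded as the nonempty set of legs which run into it, and the vertices partition the set of all
legs. Loops and multiple edges are allowed. -/
@[ext]
structure QGraph (m : ℕ) where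
  /-- all vertices, each one being the set of legs running into it -/
  vertices : Finpartition (Finset.univ : Finset (Leg m))
  /-- the outer empty vertices; the other vertices are the inner empty ones -/
  outer : Finset (Finset (Leg m))
  outer_subset : outer ⊆ vertices.parts
  card_outer : ∀ v ∈ outer, v.card = 1

instance (m : ℕ) : Fintype (QGraph m) :=
  Fintype.ofInjective (fun G : QGraph m => (G.vertices, G.outer)) fun _ _ h =>
    QGraph.ext (congrArg Prod.fst h) (congrArg Prod.snd h)

/-- The inner empty vertices of a graph. -/
def QGraph.inner {m : ℕ} (G : QGraph m) : Finset (Finset (Leg m)) :=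
  G.vertices.parts \ G.outer

/-- The value `𝓥[G](t, φ)` of a graph for `V(φ) = ‖φ‖²`, that is, `λ_{X Y} = δ_{X Y}`: give an index
`X_j ∈ {1, …, d}` to each edge, multiply by `-φ_{X}` for each outer empty vertex and by
`t C_{X_1 … X_l}` for each inner empty vertex with `l` legs (the index of a loop occurs twice), and
sum over all assignments of indices. -/
def QGraph.value {d m : ℕ} (a : Space d) (z : ℝ) (r : Measure (Space d)) (t : ℝ) (φ : Space d)
    (G : QGraph m) : ℝ :=
  ∑ X : Fin m → Fin d,
    (∏ v ∈ G.outer, ∏ h ∈ v, -φ (X h.1)) *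
      ∏ v ∈ G.inner, t * coeffC a z r (fun i : Fin v.card => X (v.equivFin.symm i).1.1)

/-- The `m`-th term `(-τ)^m / (m!)^2 * ∑_{G ∈ Q̄(m)} 𝓥[G](t, φ)` of the Borel transformed series. -/
def borelTerm {d : ℕ} (a : Space d) (z : ℝ) (r : Measure (Space d)) (t : ℝ) (φ : Space d)
    (τ : ℂ) (m : ℕ) : ℂ :=
  (-τ) ^ m / ((m.factorial : ℂ) ^ 2) * ((∑ G : QGraph m, G.value a z r t φ : ℝ) : ℂ)

/-- The striplike region `S_σ = {τ ∈ ℂ : dist (τ, [0, ∞)) < 1 / σ}`. -/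
def strip (σ : ℝ) : Set ℂ := Metric.thickening (1 / σ) ((fun x : ℝ => (x : ℂ)) '' Ici 0)

/-- `B` is an analytic continuation of the Borel transformed series (the sum of which it is near
`0`) to the strip `S_σ`. -/
def IsBorelContinuation {d : ℕ} (a : Space d) (z : ℝ) (r : Measure (Space d)) (t : ℝ) (φ : Space d)
    (σ : ℝ) (B : ℂ → ℂ) : Prop :=
  AnalyticOnNhd ℂ B (strip σ) ∧ ∀ᶠ τ in 𝓝 (0 : ℂ), HasSum (borelTerm a z r t φ τ) (B τ)

/-- The formal adjoint `μ Δ g + a · ∇ g + z ∫ [g(x + y) - g(x)] dr(y)` of the operator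
`μ Δ Φ - a · ∇ Φ + z ∫ [Φ(x - y) - Φ(x)] dr(y)`. -/
def adjointGenerator {d : ℕ} (a : Space d) (z μ : ℝ) (r : Measure (Space d))
    (g : 𝓢(Space d, ℂ)) (x : Space d) : ℂ :=
  (μ : ℂ) * (Δ (g : Space d → ℂ)) x + fderiv ℝ (g : Space d → ℂ) x a
    + (z : ℂ) * ∫ y, (g (x + y) - g x) ∂r

/-- `Φ_t`, `t > 0`, are the (continuous) densities of the jump-diffusion process started at `0`:
probability densities which solve
`∂Φ_t/∂t = μ Δ Φ_t - a · ∇ Φ_t + z ∫ [Φ_t(· - y) - Φ_t] dr(y)`, `Φ_0 = δ_0`,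
in the sense of tempered distributions. -/
structure IsLevyDensity {d : ℕ} (a : Space d) (z μ : ℝ) (r : Measure (Space d))
    (Φ : ℝ → Space d → ℝ) : Prop where
  nonneg : ∀ t, 0 < t → ∀ x, 0 ≤ Φ t x
  continuous : ∀ t, 0 < t → Continuous (Φ t)
  integrable : ∀ t, 0 < t → Integrable (Φ t)
  integral_eq_one : ∀ t, 0 < t → ∫ x, Φ t x = 1
  equation : ∀ g : 𝓢(Space d, ℂ), ∀ t, 0 < t →
    HasDerivAt (fun s : ℝ => ∫ x, (Φ s x : ℂ) * g x)
      (∫ x, (Φ t x : ℂ) * adjointGenerator a z μ r g x) t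
  initial : ∀ g : 𝓢(Space d, ℂ),
    Tendsto (fun t : ℝ => ∫ x, (Φ t x : ℂ) * g x) (𝓝[>] 0) (𝓝 (g 0))

end

end LevyBorel

/-! Write `c = t • a - φ`, and let `ν` be the compound Poisson law with rate `z * t` and jump law
`r`. At time `t` the process is the sum of `t • a`, a Gaussian and an independent variable with law
`ν`, so that `Φ_t(φ) = (β/π)^(d/2) ∫ exp (-β ‖c + x‖²) dν(x)`. The graphs compute moments. The
numbers `t C` are the cumulants of `t • a + x` under `ν`, the outer empty vertices shift the first
cumulant by `-φ`, and every edge contracts two coordinates. The moment-cumulant formula then makes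
the sum over graphs with `m` edges equal to `∫ ‖c + x‖^(2m) dν(x)` (`sum_value_eq_moment`). Since
`J₀(2√x) = ∑ (-x)^m / (m!)²`, the Borel series at `τ ≥ 0` is the `ν`-average of `J₀(2 √τ ‖c + x‖)`.
Bounded jumps give `ν` all exponential moments, so the series is even entire, and by the identity
theorem every continuation to a strip agrees with it on the half-line
(`IsBorelContinuation.eq_tsum`). The bound `|J₀| ≤ 1` makes the Laplace integral converge, and `∫
exp (-τ/β) J₀(2√(τs)) dτ = β exp (-β s)` (`integral_exp_mul_besselKernel`) together with Fubini
returns the Gaussian average. It remains to identify the density with the solution of the evolution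
equation. Existence is a computation on the Fourier side. For uniqueness (`IsLevyDensity.eq`), test
functions with compactly supported Fourier transform are used: on these the powers of the generator
grow only geometrically, so a Taylor estimate in time forces two solutions to agree. -/

namespace LevyBorel

/-! ### Set partitions, the moment-cumulant formula and sums over graphs -/

section Partitions

variable {α R : Type*} [DecidableEq α] [CommSemiring R]

/-- Splitting off the block that contains a new element `a`. -/
lemma sum_prod_finpartition_insert (κ : Finset α → R) (a : α) (S : Finset α) (ha : a ∉ S) :
    ∑ π : Finpartition (insert a S), ∏ B ∈ π.parts, κ B =
      ∑ T ∈ S.powerset, κ (insert a T) *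
        ∑ π : Finpartition (S \ T), ∏ B ∈ π.parts, κ B := by
  simp_rw [Finset.mul_sum]
  rw [Finset.sum_sigma']
  symm
  have key : ∀ T ∈ S.powerset, Disjoint (S \ T) (insert a T) ∧ (S \ T) ⊔ insert a T = insert a S := by
    intro T hT
    have hT := Finset.mem_powerset.1 hT
    constructor
    · rw [Finset.disjoint_left]
      intro x hx hx'
      simp only [Finset.mem_sdiff, Finset.mem_insert] at hx hx'
      rcases hx' with rfl | h
      · exact ha hx.1
      · exact hx.2 h
    · ext x
      have := @hT x
      simp only [Finset.sup_eq_union, Finset.mem_union, Finset.mem_sdiff, Finset.mem_insert]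
      tauto
  have hnm : ∀ (T : Finset α) (π : Finpartition (S \ T)) (B : Finset α), B ∈ π.parts → a ∉ B :=
    fun T π B hB hab => ha (Finset.mem_sdiff.1 (π.le hB hab)).1
  -- A partition of `S \ T` is extended by the block `insert a T`. Conversely, `T` is recovered by
  -- erasing `a` from the block that contains it.
  refine Finset.sum_bij
    (fun x hx => x.2.extend (b := insert a x.1) (Finset.insert_ne_empty _ _)
      (key x.1 (Finset.mem_sigma.1 hx).1).1 (key x.1 (Finset.mem_sigma.1 hx).1).2)
    (fun _ _ => Finset.mem_univ _) ?_ ?_ ?_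
  · rintro ⟨T, π⟩ h ⟨T', π'⟩ h' heq
    have hp : insert (insert a T) π.parts = insert (insert a T') π'.parts :=
      congrArg Finpartition.parts heq
    have hTS := Finset.mem_powerset.1 (Finset.mem_sigma.1 h).1
    have hTS' := Finset.mem_powerset.1 (Finset.mem_sigma.1 h').1
    dsimp only at hTS hTS'
    have hTT : insert a T = insert a T' := by
      have : insert a T ∈ insert (insert a T') π'.parts := hp ▸ Finset.mem_insert_self _ _
      rcases Finset.mem_insert.1 this with h | h
      · exact h
      · exact absurd (Finset.mem_insert_self _ _) (hnm _ _ _ h)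
    have hT : T = T' := by
      rw [← Finset.erase_insert (fun h => ha (hTS h)), hTT,
        Finset.erase_insert (fun h => ha (hTS' h))]
    subst hT
    congr 1
    ext1
    rw [← Finset.erase_insert (fun h => hnm _ π _ h (Finset.mem_insert_self _ _)), hp,
      Finset.erase_insert (fun h => hnm _ π' _ h (Finset.mem_insert_self _ _))]
  · intro P _
    have haS : a ∈ insert a S := Finset.mem_insert_self _ _
    have h1 := P.mem_part haS
    have h2 := P.part_mem.2 haS
    have hsub : P.part a ⊆ insert a S := P.le h2
    have hins : insert a ((P.part a).erase a) = P.part a := Finset.insert_erase h1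
    have hsup : (P.parts.erase (P.part a)).sup id = S \ (P.part a).erase a := by
      ext x
      simp only [Finset.mem_sup, Finset.mem_erase, id, Finset.mem_sdiff]
      constructor
      · rintro ⟨B, ⟨hB, hBP⟩, hx⟩
        have hxS := P.le hBP hx
        have hd := P.disjoint hBP h2 hB
        have hx2 : x ∉ P.part a := Finset.disjoint_left.1 hd hx
        have hxa : x ≠ a := fun h => hx2 (h ▸ h1)
        exact ⟨(Finset.mem_insert.1 hxS).resolve_left hxa, fun h => hx2 h.2⟩
      · rintro ⟨hxS, hx⟩
        have hxa : x ≠ a := fun h => ha (h ▸ hxS)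
        have hxS' : x ∈ insert a S := Finset.mem_insert_of_mem hxS
        have hx' : x ∉ P.part a := fun h => hx ⟨hxa, h⟩
        exact ⟨P.part x, ⟨fun h => hx' (h ▸ P.mem_part hxS'), P.part_mem.2 hxS'⟩,
          P.mem_part hxS'⟩
    refine ⟨⟨(P.part a).erase a, P.ofSubset (Finset.erase_subset _ _) hsup⟩, ?_, ?_⟩
    · simp only [Finset.mem_sigma, Finset.mem_powerset, Finset.mem_univ, and_true]
      intro x hx
      exact (Finset.mem_insert.1 (hsub (Finset.mem_of_mem_erase hx))).resolve_left
        (Finset.ne_of_mem_erase hx)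
    · ext1
      change insert (insert a ((P.part a).erase a)) (P.parts.erase (P.part a)) = P.parts
      rw [hins, Finset.insert_erase h2]
  · rintro ⟨T, π⟩ h
    exact (Finset.prod_insert fun h => hnm _ π _ h (Finset.mem_insert_self _ _)).symm

/-- Moments that satisfy the moment-cumulant recursion are sums over partitions. -/
lemma moment_eq_sum_finpartition (κ M : Finset α → R) (h0 : M ∅ = 1)
    (hM : ∀ a S, a ∉ S → M (insert a S) = ∑ T ∈ S.powerset, κ (insert a T) * M (S \ T))
    (S : Finset α) : M S = ∑ π : Finpartition S, ∏ B ∈ π.parts, κ B := by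
  induction S using Finset.strongInduction with
  | H S ih =>
    rcases S.eq_empty_or_nonempty with rfl | ⟨a, ha⟩
    · have hp (π : Finpartition (∅ : Finset α)) : π.parts = ∅ := π.parts_eq_empty_iff.2 rfl
      let _ : Unique (Finpartition (∅ : Finset α)) :=
        inferInstanceAs (Unique (Finpartition (⊥ : Finset α)))
      rw [h0, Fintype.sum_unique, hp, Finset.prod_empty]
    · obtain ⟨S', ha', rfl⟩ : ∃ S', a ∉ S' ∧ S = insert a S' :=
        ⟨S.erase a, Finset.notMem_erase _ _, (Finset.insert_erase ha).symm⟩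
      rw [hM a S' ha', sum_prod_finpartition_insert κ a S' ha']
      refine Finset.sum_congr rfl fun T _ => ?_
      rw [ih]
      exact (Finset.ssubset_insert ha').trans_le' Finset.sdiff_subset

end Partitions

/-- Summing over the outer vertices of graphs with a given vertex partition. -/
lemma sum_qGraph_eq_sum_finpartition {R : Type*} [CommSemiring R] (m : ℕ)
    (p q : Finset (Leg m) → R) :
    ∑ G : QGraph m, (∏ v ∈ G.outer, p v) * ∏ v ∈ G.inner, q v =
      ∑ π : Finpartition (Finset.univ : Finset (Leg m)),
        ∏ v ∈ π.parts, ((if v.card = 1 then p v else 0) + q v) := by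
  -- Expanding the product chooses which blocks are outer. The value `0` on blocks with more than
  -- one leg kills the choices that are not graphs.
  simp_rw [Finset.prod_add]
  rw [Finset.sum_sigma']
  refine Finset.sum_of_injOn (fun G => ⟨G.vertices, G.outer⟩) ?_ ?_ ?_ ?_
  · rintro G - G' - h
    simp only [Sigma.mk.injEq] at h
    exact QGraph.ext h.1 (eq_of_heq h.2)
  · intro G _
    simpa using G.outer_subset
  · rintro ⟨π, t⟩ h hn
    simp only [Finset.mem_sigma, Finset.mem_powerset, Finset.mem_univ, true_and] at h
    have : ∃ v ∈ t, v.card ≠ 1 := by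
      by_contra! hc
      exact hn ⟨⟨π, t, h, hc⟩, by simp, rfl⟩
    obtain ⟨v, hv, hc⟩ := this
    rw [Finset.prod_eq_zero hv (if_neg hc), zero_mul]
  · intro G _
    simp only [QGraph.inner]
    congr 1
    exact Finset.prod_congr rfl fun v hv => (if_pos (G.card_outer v hv)).symm

open ProbabilityTheory
open scoped NNReal

/-! ### The compound Poisson law: exponential moments, characteristic function, Mecke's formula -/

section CompoundPoisson

variable {d : ℕ}

/-- Strongly measurable functions of at most exponential growth. -/
def ExpBounded {E : Type*} [NormedAddCommGroup E] (f : Space d → E) : Prop :=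
  StronglyMeasurable f ∧ ∃ C s : ℝ, 0 ≤ C ∧ 0 ≤ s ∧ ∀ x, ‖f x‖ ≤ C * Real.exp (s * ‖x‖)

/-- The convolution powers of a measure. -/
noncomputable def convPow (r : Measure (Space d)) : ℕ → Measure (Space d)
  | 0 => Measure.dirac 0
  | n + 1 => r.conv (convPow r n)

instance (r : Measure (Space d)) [IsProbabilityMeasure r] (n : ℕ) :
    IsProbabilityMeasure (convPow r n) := by
  induction n with
  | zero => exact inferInstanceAs (IsProbabilityMeasure (Measure.dirac 0))
  | succ n ih => exact inferInstanceAs (IsProbabilityMeasure (r.conv (convPow r n)))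

/-- The convolution powers as a kernel. -/
noncomputable def convPowKernel (r : Measure (Space d)) : Kernel ℕ (Space d) :=
  Kernel.ofFunOfCountable (convPow r)

instance (r : Measure (Space d)) [IsProbabilityMeasure r] : IsMarkovKernel (convPowKernel r) :=
  ⟨fun n => inferInstanceAs (IsProbabilityMeasure (convPow r n))⟩

/-- The compound Poisson distribution with rate `l` and jump distribution `r`. -/
noncomputable def compoundPoisson (l : ℝ≥0) (r : Measure (Space d)) : Measure (Space d) :=
  convPowKernel r ∘ₘ poissonMeasure l

instance (l : ℝ≥0) (r : Measure (Space d)) [IsProbabilityMeasure r] :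
    IsProbabilityMeasure (compoundPoisson l r) :=
  inferInstanceAs (IsProbabilityMeasure (convPowKernel r ∘ₘ poissonMeasure l))

lemma exists_ae_norm_le (r : Measure (Space d)) (hr : IsCompact r.support) :
    ∃ R : ℝ, 0 ≤ R ∧ ∀ᵐ y ∂r, ‖y‖ ≤ R := by
  obtain ⟨R, hR⟩ := hr.isBounded.exists_norm_le
  refine ⟨max R 0, le_max_right _ _, ?_⟩
  filter_upwards [Measure.support_mem_ae] with y hy
  exact (hR y hy).trans (le_max_left _ _)

variable {r : Measure (Space d)} [IsProbabilityMeasure r] {R : ℝ}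

omit [IsProbabilityMeasure r] in
lemma ae_norm_convPow_le (hR : ∀ᵐ y ∂r, ‖y‖ ≤ R) (n : ℕ) :
    ∀ᵐ x ∂convPow r n, ‖x‖ ≤ n * R := by
  induction n with
  | zero => simp [convPow, ae_dirac_eq]
  | succ n ih =>
    have hm : MeasurableSet {x : Space d | ‖x‖ ≤ ((n + 1 : ℕ) : ℝ) * R} :=
      measurableSet_le measurable_norm measurable_const
    change ∀ᵐ x ∂(Measure.map (fun x : Space d × Space d => x.1 + x.2) (r.prod (convPow r n))), _
    rw [ae_map_iff (by fun_prop) hm]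
    have h1 : ∀ᵐ p ∂(r.prod (convPow r n)), ‖p.1‖ ≤ R :=
      Measure.quasiMeasurePreserving_fst.ae hR
    have h2 : ∀ᵐ p ∂(r.prod (convPow r n)), ‖p.2‖ ≤ n * R :=
      Measure.quasiMeasurePreserving_snd.ae ih
    filter_upwards [h1, h2] with p h1 h2
    calc ‖p.1 + p.2‖ ≤ ‖p.1‖ + ‖p.2‖ := norm_add_le _ _
      _ ≤ R + n * R := add_le_add h1 h2
      _ = _ := by push_cast; ring

section Growth

variable {E : Type*} [NormedAddCommGroup E]

lemma ExpBounded.integrable_of_bounded {f : Space d → E} (hf : ExpBounded f)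
    {ρ : Measure (Space d)} [IsFiniteMeasure ρ] {R : ℝ} (hR : ∀ᵐ x ∂ρ, ‖x‖ ≤ R) :
    Integrable f ρ := by
  obtain ⟨hm, C, s, hC, hs, hb⟩ := hf
  refine Integrable.of_bound hm.aestronglyMeasurable (C * Real.exp (s * R)) ?_
  filter_upwards [hR] with x hx
  refine (hb x).trans ?_
  gcongr

/-- After `n` jumps of size at most `R`, growth `exp (s ‖x‖)` costs at most `exp (s R) ^ n`, and the
Poisson weights `l ^ n / n!` absorb every geometric factor. -/
lemma ExpBounded.integrable_compoundPoisson {f : Space d → E} (hf : ExpBounded f)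
    (hR : ∀ᵐ y ∂r, ‖y‖ ≤ R) (l : ℝ≥0) : Integrable f (compoundPoisson l r) := by
  obtain ⟨hm, C, s, hC, hs, hb⟩ := id hf
  rw [compoundPoisson, Measure.integrable_comp_iff hm.aestronglyMeasurable]
  have hi (n : ℕ) : Integrable f (convPow r n) :=
    hf.integrable_of_bounded (ae_norm_convPow_le hR n)
  refine ⟨ae_of_all _ hi, ?_⟩
  rw [integrable_poissonMeasure_iff]
  have hsum : Summable fun n : ℕ => Real.exp (-l) * C *
      ((l * Real.exp (s * R)) ^ n / n.factorial) :=
    (Real.summable_pow_div_factorial _).mul_left _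
  refine Summable.of_nonneg_of_le (fun n => by positivity) (fun n => ?_) hsum
  have h1 : ‖∫ x, ‖f x‖ ∂convPow r n‖ ≤ C * Real.exp (s * (n * R)) := by
    have := norm_integral_le_of_norm_le_const (μ := convPow r n) (f := fun x => ‖f x‖)
      (C := C * Real.exp (s * (n * R))) (by
        filter_upwards [ae_norm_convPow_le hR n] with x hx
        rw [norm_norm]
        refine (hb x).trans ?_
        gcongr)
    simpa using this
  calc Real.exp (-l) * l ^ n / n.factorial * ‖∫ x, ‖f x‖ ∂convPow r n‖
      ≤ Real.exp (-l) * l ^ n / n.factorial * (C * Real.exp (s * (n * R))) := by gcongr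
    _ = _ := by
      rw [mul_pow, ← Real.exp_nat_mul]
      ring_nf

lemma ExpBounded.comp_add {f : Space d → E} (hf : ExpBounded f) (y : Space d) :
    ExpBounded fun x => f (y + x) := by
  obtain ⟨hm, C, s, hC, hs, hb⟩ := hf
  refine ⟨hm.comp_measurable (by fun_prop), C * Real.exp (s * ‖y‖), s, by positivity, hs,
    fun x => (hb _).trans ?_⟩
  rw [mul_assoc, ← Real.exp_add, ← mul_add]
  gcongr
  exact norm_add_le _ _

lemma ExpBounded.mul {f g : Space d → ℝ} (hf : ExpBounded f) (hg : ExpBounded g) :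
    ExpBounded fun x => f x * g x := by
  obtain ⟨hm, C, s, hC, hs, hb⟩ := hf
  obtain ⟨hm', C', s', hC', hs', hb'⟩ := hg
  refine ⟨hm.mul hm', C * C', s + s', by positivity, by positivity, fun x => ?_⟩
  rw [norm_mul, add_mul, Real.exp_add]
  calc ‖f x‖ * ‖g x‖ ≤ (C * Real.exp (s * ‖x‖)) * (C' * Real.exp (s' * ‖x‖)) := by
        gcongr
        exacts [hb x, hb' x]
    _ = _ := by ring

lemma expBounded_const (c : E) : ExpBounded fun _ : Space d => c :=
  ⟨stronglyMeasurable_const, ‖c‖, 0, norm_nonneg _, le_rfl, fun x => by simp⟩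

lemma ExpBounded.prod {ι : Type*} {f : ι → Space d → ℝ} (S : Finset ι)
    (hf : ∀ i, ExpBounded (f i)) : ExpBounded fun x => ∏ i ∈ S, f i x := by
  classical
  induction S using Finset.induction_on with
  | empty => simpa using expBounded_const (1 : ℝ)
  | insert a S ha ih =>
    simp_rw [Finset.prod_insert ha]
    exact (hf a).mul ih

lemma expBounded_coord (i : Fin d) : ExpBounded fun x : Space d => x i := by
  refine ⟨(by fun_prop : Continuous fun x : Space d => x i).stronglyMeasurable, 1, 1, by simp,
    by simp, fun x => ?_⟩
  have h1 : ‖x i‖ ≤ ‖x‖ := PiLp.norm_apply_le x i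
  have h2 := Real.add_one_le_exp ‖x‖
  rw [one_mul, one_mul]
  linarith

lemma expBounded_exp_norm {s : ℝ} (hs : 0 ≤ s) :
    ExpBounded fun x : Space d => Real.exp (s * ‖x‖) :=
  ⟨(by fun_prop : Continuous fun x : Space d => Real.exp (s * ‖x‖)).stronglyMeasurable, 1, s,
    by simp, hs, fun x => by simp⟩

lemma ExpBounded.mono {E' : Type*} [NormedAddCommGroup E'] {f : Space d → E} {g : Space d → E'}
    (hf : ExpBounded f) (hg : StronglyMeasurable g) (h : ∀ x, ‖g x‖ ≤ ‖f x‖) : ExpBounded g := by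
  obtain ⟨hm, C, s, hC, hs, hb⟩ := hf
  exact ⟨hg, C, s, hC, hs, fun x => (h x).trans (hb x)⟩

end Growth

omit [IsProbabilityMeasure r] in
lemma integral_compoundPoisson {E : Type*} [NormedAddCommGroup E] [NormedSpace ℝ E]
    [CompleteSpace E] (l : ℝ≥0) {f : Space d → E} (hf : Integrable f (compoundPoisson l r)) :
    HasSum (fun n : ℕ => (Real.exp (-l) * l ^ n / n.factorial) • ∫ x, f x ∂convPow r n)
      (∫ x, f x ∂compoundPoisson l r) := by
  have hf' : Integrable f ((convPowKernel r ∘ₖ Kernel.const Unit (poissonMeasure l)) ()) := by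
    rwa [← Measure.comp_eq_comp_const_apply]
  have hi : Integrable (fun n => ∫ x, f x ∂convPowKernel r n) (poissonMeasure l) := by
    simpa only [Kernel.const_apply] using hf'.integral_comp
  have h := hasSum_integral_poissonMeasure hi
  have he : ∫ x, f x ∂compoundPoisson l r =
      ∫ n, ∫ x, f x ∂convPowKernel r n ∂poissonMeasure l := by
    rw [compoundPoisson, Measure.comp_eq_comp_const_apply, Kernel.integral_comp hf',
      Kernel.const_apply]
  rw [he]
  exact h

lemma charFun_convPow (n : ℕ) (ξ : Space d) :
    charFun (convPow r n) ξ = charFun r ξ ^ n := by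
  induction n with
  | zero => simp [convPow]
  | succ n ih => rw [convPow, charFun_conv, ih, pow_succ']

lemma charFun_compoundPoisson (l : ℝ≥0) (ξ : Space d) :
    charFun (compoundPoisson l r) ξ = Complex.exp (l * (charFun r ξ - 1)) := by
  have hi : Integrable (fun x : Space d => Complex.exp (inner ℝ x ξ * Complex.I))
      (compoundPoisson l r) := by
    refine Integrable.of_bound (by fun_prop) 1 (ae_of_all _ fun x => ?_)
    rw [Complex.norm_exp_ofReal_mul_I]
  have h1 := integral_compoundPoisson l hi
  have h2 : HasSum (fun n : ℕ => (Real.exp (-l) * l ^ n / n.factorial) •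
      ∫ x, Complex.exp (inner ℝ x ξ * Complex.I) ∂convPow r n)
      (Complex.exp (-l) * Complex.exp (l * charFun r ξ)) := by
    have := (NormedSpace.expSeries_div_hasSum_exp ((l : ℂ) * charFun r ξ)).mul_left
      (Complex.exp (-l))
    rw [← Complex.exp_eq_exp_ℂ] at this
    refine this.congr_fun fun n => ?_
    rw [← charFun_apply, charFun_convPow]
    simp only [Complex.real_smul]
    push_cast
    rw [mul_pow]
    ring
  rw [charFun_apply, h1.unique h2, ← Complex.exp_add]
  ring_nf

lemma integrable_coord_mul_comp_add {ρ : Measure (Space d)} [IsFiniteMeasure ρ] {R' : ℝ}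
    (hR : ∀ᵐ y ∂r, ‖y‖ ≤ R) (hR' : ∀ᵐ x ∂ρ, ‖x‖ ≤ R')
    {f g : Space d → ℝ} (hf : ExpBounded f) (hg : ExpBounded g) :
    Integrable (fun p : Space d × Space d => g p.1 * f (p.1 + p.2)) (r.prod ρ) := by
  obtain ⟨hm, C, s, hC, hs, hb⟩ := hf
  obtain ⟨hm', C', s', hC', hs', hb'⟩ := hg
  have h1 : ∀ᵐ p ∂(r.prod ρ), ‖p.1‖ ≤ R := Measure.quasiMeasurePreserving_fst.ae hR
  have h2 : ∀ᵐ p ∂(r.prod ρ), ‖p.2‖ ≤ R' := Measure.quasiMeasurePreserving_snd.ae hR'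
  refine Integrable.of_bound ?_ ((C' * Real.exp (s' * R)) * (C * Real.exp (s * (R + R')))) ?_
  · exact ((hm'.comp_measurable (by fun_prop)).mul
      (hm.comp_measurable (by fun_prop))).aestronglyMeasurable
  · filter_upwards [h1, h2] with p h1 h2
    rw [norm_mul]
    gcongr
    · refine (hb' _).trans ?_
      gcongr
    · refine (hb _).trans ?_
      gcongr
      exact (norm_add_le _ _).trans (add_le_add h1 h2)

/-- The function `x ↦ ∫ y_i f (y + x) dr(y)`. -/
lemma ExpBounded.integral_coord_mul (hR : ∀ᵐ y ∂r, ‖y‖ ≤ R) (hR0 : 0 ≤ R)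
    {f : Space d → ℝ} (hf : ExpBounded f) (i : Fin d) :
    ExpBounded fun x => ∫ y, y i * f (y + x) ∂r := by
  obtain ⟨hm, C, s, hC, hs, hb⟩ := hf
  have hm2 : StronglyMeasurable fun p : Space d × Space d => p.2 i * f (p.2 + p.1) :=
    (by fun_prop : Continuous fun p : Space d × Space d => p.2 i).stronglyMeasurable.mul
      (hm.comp_measurable (by fun_prop))
  refine ⟨hm2.integral_prod_right, R * (C * Real.exp (s * R)), s, by positivity, hs, fun x => ?_⟩
  have := norm_integral_le_of_norm_le_const (μ := r) (f := fun y => y i * f (y + x))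
      (C := R * (C * Real.exp (s * R)) * Real.exp (s * ‖x‖)) (by
        filter_upwards [hR] with y hy
        rw [norm_mul, mul_assoc, mul_assoc, ← Real.exp_add, ← mul_add]
        gcongr
        · exact (PiLp.norm_apply_le y i).trans hy
        · refine (hb _).trans ?_
          gcongr
          exact (norm_add_le _ _).trans (by gcongr))
  simpa using this

/-- By exchangeability each of the `n + 1` jumps contributes equally to the coordinate of the sum.
The induction splits off one jump: its own coordinate gives one copy of the right-hand integral, and
the remaining jumps give the others. -/
lemma integral_coord_mul_convPow (hR0 : 0 ≤ R) (hR : ∀ᵐ y ∂r, ‖y‖ ≤ R) (i : Fin d) (n : ℕ)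
    {f : Space d → ℝ} (hf : ExpBounded f) :
    ∫ x, x i * f x ∂convPow r (n + 1) =
      (n + 1) * ∫ x, ∫ y, y i * f (y + x) ∂r ∂convPow r n := by
  have hconv (m : ℕ) {g : Space d → ℝ} (hg : ExpBounded g) :
      ∫ x, g x ∂convPow r (m + 1) = ∫ y, ∫ x, g (y + x) ∂convPow r m ∂r :=
    integral_conv (hg.integrable_of_bounded (ae_norm_convPow_le hR (m + 1)))
  induction n generalizing f with
  | zero =>
    rw [hconv 0 ((expBounded_coord i).mul hf)]
    simp [convPow]
  | succ n ih =>
    have hxf := (expBounded_coord i).mul hf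
    have hae := ae_norm_convPow_le hR (n + 1)
    have hi1 := integrable_coord_mul_comp_add hR hae hf (expBounded_coord i)
    have hi2 := integrable_coord_mul_comp_add hR hae hxf (expBounded_const 1)
    have hsplit : ∀ᵐ y ∂r, ∫ x, (y + x) i * f (y + x) ∂convPow r (n + 1) =
        ∫ x, y i * f (y + x) ∂convPow r (n + 1) +
          (n + 1) * ∫ x, ∫ y', y' i * f (y' + (y + x)) ∂r ∂convPow r n := by
      refine ae_of_all _ fun y => ?_
      have e1 : ∫ x, x i * f (y + x) ∂convPow r (n + 1) =
          (n + 1) * ∫ x, ∫ y', y' i * f (y' + (y + x)) ∂r ∂convPow r n := by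
        rw [ih (hf.comp_add y)]
        simp_rw [← add_assoc, add_comm y]
      rw [← e1, ← integral_add]
      · simp only [PiLp.add_apply, add_mul]
      · exact ((hf.comp_add y).integrable_of_bounded hae).const_mul _
      · exact ((expBounded_coord i).mul (hf.comp_add y)).integrable_of_bounded hae
    have hh := hf.integral_coord_mul hR hR0 i
    have hi3 := integrable_coord_mul_comp_add hR (ae_norm_convPow_le hR n) hh (expBounded_const 1)
    simp only [one_mul] at hi3
    rw [hconv (n + 1) hxf, integral_congr_ae hsplit, integral_add hi1.integral_prod_left
      (hi3.integral_prod_left.const_mul _), integral_integral_swap hi1, integral_const_mul,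
      hconv n hh]
    push_cast
    ring

/-- Mecke's formula for the compound Poisson distribution. -/
lemma integral_coord_mul_compoundPoisson (hR0 : 0 ≤ R) (hR : ∀ᵐ y ∂r, ‖y‖ ≤ R) (i : Fin d)
    (l : ℝ≥0) {f : Space d → ℝ} (hf : ExpBounded f) :
    ∫ x, x i * f x ∂compoundPoisson l r =
      l * ∫ x, ∫ y, y i * f (y + x) ∂r ∂compoundPoisson l r := by
  have hxf := (expBounded_coord i).mul hf
  have h1 := integral_compoundPoisson l (hxf.integrable_compoundPoisson hR l)
  have h2 := (integral_compoundPoisson l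
    ((hf.integral_coord_mul hR hR0 i).integrable_compoundPoisson hR l)).mul_left (l : ℝ)
  -- The coordinate vanishes in the term without jumps. In the others the factor `n + 1` cancels
  -- against `(n + 1)!`, which shifts the Poisson weights by one and leaves a factor `l`.
  rw [← hasSum_nat_add_iff' 1] at h1
  have h0 : ∫ x, x i * f x ∂convPow r 0 = 0 := by simp [convPow]
  simp only [Finset.range_one, Finset.sum_singleton, h0, smul_zero, sub_zero] at h1
  refine h1.unique (h2.congr_fun fun n => ?_)
  rw [integral_coord_mul_convPow hR0 hR i n hf, Nat.factorial_succ]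
  simp only [smul_eq_mul]
  push_cast
  field_simp
  ring

end CompoundPoisson

/-! ### Derivatives of the symbol as cumulants, and graph sums as moments -/

section Cumulants

variable {d : ℕ} {r : Measure (Space d)} [IsProbabilityMeasure r] {R : ℝ}

/-- The multilinear form `v ↦ ∏ i, ⟨y, v i⟩`. -/
noncomputable def innerPow (n : ℕ) (y : Space d) :
    ContinuousMultilinearMap ℝ (fun _ : Fin n => Space d) ℝ :=
  (ContinuousMultilinearMap.mkPiAlgebra ℝ (Fin n) ℝ).compContinuousLinearMap
    (fun _ => innerSL ℝ y)

lemma innerPow_apply (n : ℕ) (y : Space d) (v : Fin n → Space d) :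
    innerPow n y v = ∏ i, inner ℝ y (v i) := by
  simp [innerPow]

lemma continuous_innerPow (n : ℕ) : Continuous (innerPow (d := d) n) := by
  have h := (ContinuousMultilinearMap.compContinuousLinearMapContinuousMultilinear ℝ
    (fun _ : Fin n => Space d) (fun _ : Fin n => ℝ) ℝ).cont
  have h2 : Continuous fun y : Space d => fun _ : Fin n => innerSL ℝ y :=
    continuous_pi fun _ => (innerSL ℝ).continuous
  exact (h.comp h2).clm_apply continuous_const

lemma norm_innerPow_le (n : ℕ) (y : Space d) : ‖innerPow n y‖ ≤ ‖y‖ ^ n := by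
  refine (ContinuousMultilinearMap.norm_compContinuousLinearMap_le _ _).trans ?_
  simp

lemma integrable_innerPow (hR : ∀ᵐ y ∂r, ‖y‖ ≤ R) (n : ℕ) : Integrable (innerPow n) r := by
  refine Integrable.of_bound (continuous_innerPow n).aestronglyMeasurable (R ^ n) ?_
  filter_upwards [hR] with y hy
  exact (norm_innerPow_le n y).trans (by gcongr)

/-- The Taylor series at `0` of `η ↦ ∫ exp ⟨y, η⟩ dr(y)`. -/
noncomputable def innerPowSeries (r : Measure (Space d)) :
    FormalMultilinearSeries ℝ (Space d) ℝ :=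
  fun n => (n.factorial : ℝ)⁻¹ • ∫ y, innerPow n y ∂r

/-- The exponential series is integrated term by term, dominated by the series of `exp (R ‖η‖)`. The
radius `1` is a convenience, as only derivatives at `0` are needed. -/
lemma hasFPowerSeriesOnBall_integral_exp (hR0 : 0 ≤ R) (hR : ∀ᵐ y ∂r, ‖y‖ ≤ R) :
    HasFPowerSeriesOnBall (fun η : Space d => ∫ y, Real.exp (inner ℝ y η) ∂r)
      (innerPowSeries r) 0 1 where
  r_le := by
    refine FormalMultilinearSeries.le_radius_of_bound _ (Real.exp R) fun n => ?_
    simp only [innerPowSeries, NNReal.coe_one, one_pow, mul_one]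
    have h1 : ‖∫ y, innerPow n y ∂r‖ ≤ R ^ n := by
      have := norm_integral_le_of_norm_le_const (μ := r) (f := innerPow n) (C := R ^ n) (by
        filter_upwards [hR] with y hy
        exact (norm_innerPow_le n y).trans (by gcongr))
      simpa using this
    rw [norm_smul, norm_inv, RCLike.norm_natCast, inv_mul_eq_div]
    calc _ ≤ R ^ n / n.factorial := by gcongr
      _ ≤ Real.exp R := Real.pow_div_factorial_le_exp R hR0 n
  r_pos := one_pos
  hasSum := by
    intro η _
    rw [zero_add]
    have h1 (n : ℕ) : innerPowSeries r n (fun _ => η) =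
        ∫ y, (n.factorial : ℝ)⁻¹ * (inner ℝ y η) ^ n ∂r := by
      rw [innerPowSeries, smul_apply,
        ContinuousMultilinearMap.integral_apply (integrable_innerPow hR n), integral_const_mul]
      simp [innerPow_apply]
    simp_rw [h1]
    refine hasSum_integral_of_dominated_convergence
      (fun n _ => (R * ‖η‖) ^ n / n.factorial) (fun n => by fun_prop) (fun n => ?_)
      (ae_of_all _ fun _ => Real.summable_pow_div_factorial _) (integrable_const _)
      (ae_of_all _ fun y => ?_)
    · filter_upwards [hR] with y hy
      rw [norm_mul, norm_inv, RCLike.norm_natCast, inv_mul_eq_div, norm_pow]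
      gcongr
      exact (norm_inner_le_norm y η).trans (by gcongr)
    · have := NormedSpace.expSeries_div_hasSum_exp (inner ℝ y η : ℝ)
      rw [← Real.exp_eq_exp_ℝ] at this
      simpa only [inv_mul_eq_div] using this

lemma integrable_exp_inner (hR : ∀ᵐ y ∂r, ‖y‖ ≤ R) (η : Space d) :
    Integrable (fun y => Real.exp (inner ℝ y η)) r := by
  refine Integrable.of_bound (by fun_prop) (Real.exp (R * ‖η‖)) ?_
  filter_upwards [hR] with y hy
  rw [Real.norm_eq_abs, Real.abs_exp]
  gcongr
  exact (real_inner_le_norm y η).trans (by gcongr)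

/-- The iterated derivative symmetrizes the power series coefficient. All `n!` permuted terms are
equal and cancel the `1 / n!`, while the drift enters only in degree one. The case `n = 0` is
excluded because of the subtracted `1` in the symbol; vertices always have a leg. -/
lemma coeffC_eq (hR0 : 0 ≤ R) (hR : ∀ᵐ y ∂r, ‖y‖ ≤ R) (a : Space d) (z : ℝ) {n : ℕ}
    (hn : n ≠ 0) (X : Fin n → Fin d) :
    coeffC a z r X = (if n = 1 then ∏ i, a (X i) else 0) + z * ∫ y, ∏ i, y (X i) ∂r := by
  have hs := ((innerSL ℝ a).hasFPowerSeriesOnBall 0).mono one_pos le_top |>.add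
    (((hasFPowerSeriesOnBall_integral_exp hR0 hR).sub
      ((hasFPowerSeriesOnBall_const (𝕜 := ℝ) (c := (1 : ℝ)) (e := (0 : Space d))).mono
        one_pos le_top)).const_smul (c := z))
  have hf : jumpSymbol a z r = (⇑(innerSL ℝ a) +
      z • ((fun η : Space d => ∫ y, Real.exp (inner ℝ y η) ∂r) - fun _ => (1 : ℝ))) := by
    ext η
    simp only [jumpSymbol, Pi.add_apply, Pi.smul_apply, Pi.sub_apply, smul_eq_mul]
    rw [integral_sub (integrable_exp_inner hR η) (integrable_const _)]
    simp
  rw [coeffC, hf, hs.iteratedFDeriv_eq_sum_of_completeSpace]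
  have h2 (v : Fin n → Space d) :
      (∫ y, innerPow n y ∂r) v = ∫ y, ∏ i, inner ℝ y (v i) ∂r := by
    rw [ContinuousMultilinearMap.integral_apply (integrable_innerPow hR n)]
    simp [innerPow_apply]
  have h3 (σ : Equiv.Perm (Fin n)) :
      ∫ y, ∏ i, inner ℝ y (EuclideanSpace.single (X (σ i)) (1 : ℝ)) ∂r =
        ∫ y, ∏ i, y (X i) ∂r := by
    congr 1 with y
    rw [Equiv.prod_comp σ fun i => inner ℝ y (EuclideanSpace.single (X i) (1 : ℝ))]
    simp [EuclideanSpace.inner_single_right]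
  have h4 (v : Fin n → Space d) :
      ((innerSL ℝ a).fpowerSeries 0 n) v = if n = 1 then ∏ i, inner ℝ a (v i) else 0 := by
    match n, hn with
    | 1, _ => simp
    | n + 2, _ => simp
  obtain ⟨k, rfl⟩ := Nat.exists_eq_succ_of_ne_zero hn
  have h5 (v : Fin (k + 1) → Space d) :
      ((innerPowSeries r - constFormalMultilinearSeries ℝ (Space d) (1 : ℝ)) (k + 1)) v =
        ((k + 1).factorial : ℝ)⁻¹ * ∫ y, ∏ i, inner ℝ y (v i) ∂r := by
    change (((((k + 1).factorial : ℝ)⁻¹ • ∫ y, innerPow (k + 1) y ∂r) -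
      constFormalMultilinearSeries ℝ (Space d) (1 : ℝ) (k + 1) :
        ContinuousMultilinearMap ℝ (fun _ : Fin (k + 1) => Space d) ℝ)) v = _
    rw [constFormalMultilinearSeries_apply_succ, sub_zero, smul_apply, h2, smul_eq_mul]
  simp only [FormalMultilinearSeries.add_apply, FormalMultilinearSeries.smul_apply, add_apply,
    smul_apply, h5, h3, h4, Finset.sum_add_distrib, Finset.sum_const, Finset.card_univ,
    Fintype.card_perm, Fintype.card_fin, nsmul_eq_mul, smul_eq_mul]
  congr 1
  · split_ifs with h
    · obtain rfl : k = 0 := by simpa using h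
      simp [EuclideanSpace.inner_single_right]
    · simp
  · have : ((k + 1).factorial : ℝ) ≠ 0 := by positivity
    field_simp

lemma coeffC_vertex (hR0 : 0 ≤ R) (hR : ∀ᵐ y ∂r, ‖y‖ ≤ R) (a : Space d) (z : ℝ) {m : ℕ}
    (X : Fin m → Fin d) (v : Finset (Leg m)) (hv : v.Nonempty) :
    coeffC a z r (fun i : Fin v.card => X (v.equivFin.symm i).1.1) =
      (if v.card = 1 then ∏ h ∈ v, a (X h.1) else 0) + z * ∫ y, ∏ h ∈ v, y (X h.1) ∂r := by
  have key (y : Space d) : ∏ i : Fin v.card, y (X (v.equivFin.symm i).1.1) =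
      ∏ h ∈ v, y (X h.1) := by
    rw [Equiv.prod_comp v.equivFin.symm fun h : v => y (X h.1.1),
      Finset.prod_coe_sort v fun h => y (X h.1)]
  rw [coeffC_eq hR0 hR a z hv.card_pos.ne']
  simp_rw [key]

/-- The moment-cumulant recursion for products of coordinates of a compound Poisson variable
with a deterministic shift `b`. -/
lemma moment_insert (hR0 : 0 ≤ R) (hR : ∀ᵐ y ∂r, ‖y‖ ≤ R) (l : ℝ≥0) {ι : Type*} [DecidableEq ι]
    (b : Space d) (X : ι → Fin d) (i : ι) (S : Finset ι) (hi : i ∉ S) :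
    ∫ x, ∏ h ∈ insert i S, (b + x) (X h) ∂compoundPoisson l r =
      ∑ T ∈ S.powerset, ((if (insert i T).card = 1 then ∏ h ∈ insert i T, b (X h) else 0) +
        l * ∫ y, ∏ h ∈ insert i T, y (X h) ∂r) *
          ∫ x, ∏ h ∈ S \ T, (b + x) (X h) ∂compoundPoisson l r := by
  have hprod (S : Finset ι) : ExpBounded fun x : Space d => ∏ h ∈ S, (b + x) (X h) :=
    ExpBounded.prod S fun h => (expBounded_coord (X h)).comp_add b
  have hint (S : Finset ι) : Integrable (fun x : Space d => ∏ h ∈ S, (b + x) (X h))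
    (compoundPoisson l r) := (hprod S).integrable_compoundPoisson hR l
  -- The coordinate of `b + x` at `i` splits into a constant and a coordinate of `x`, and Mecke's
  -- formula trades the latter for an extra jump `y`.
  have hL : ∫ x, ∏ h ∈ insert i S, (b + x) (X h) ∂compoundPoisson l r =
      b (X i) * ∫ x, ∏ h ∈ S, (b + x) (X h) ∂compoundPoisson l r +
        l * ∫ x, ∫ y, y (X i) * ∏ h ∈ S, (b + (y + x)) (X h) ∂r ∂compoundPoisson l r := by
    rw [← integral_coord_mul_compoundPoisson hR0 hR (X i) l (hprod S), ← integral_const_mul,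
      ← integral_add ((hint S).const_mul _)
        (((expBounded_coord (X i)).mul (hprod S)).integrable_compoundPoisson hR l)]
    congr 1 with x
    rw [Finset.prod_insert hi, PiLp.add_apply, add_mul]
  have hexp (x : Space d) : ∫ y, y (X i) * ∏ h ∈ S, (b + (y + x)) (X h) ∂r =
      ∑ T ∈ S.powerset, (∫ y, ∏ h ∈ insert i T, y (X h) ∂r) * ∏ h ∈ S \ T, (b + x) (X h) := by
    -- In the expanded product, `T` collects the factors that receive the extra jump `y`; together
    -- with `i` they form the block of `i`.
    have e (y : Space d) : y (X i) * ∏ h ∈ S, (b + (y + x)) (X h) =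
        ∑ T ∈ S.powerset, (∏ h ∈ insert i T, y (X h)) * ∏ h ∈ S \ T, (b + x) (X h) := by
      have : ∏ h ∈ S, (b + (y + x)) (X h) = ∏ h ∈ S, (y (X h) + (b + x) (X h)) :=
        Finset.prod_congr rfl fun h _ => by simp only [PiLp.add_apply]; ring
      rw [this, Finset.prod_add, Finset.mul_sum]
      refine Finset.sum_congr rfl fun T hT => ?_
      rw [Finset.prod_insert fun h => hi (Finset.mem_powerset.1 hT h), mul_assoc]
    simp_rw [e]
    rw [integral_finsetSum]
    · simp_rw [integral_mul_const]
    · intro T _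
      refine Integrable.mul_const ?_ _
      exact (ExpBounded.prod (insert i T) fun h =>
        expBounded_coord (X h)).integrable_of_bounded hR
  -- The deterministic shift is a first cumulant only, so it is felt just by the block `{i}`.
  have hcard : ∀ T ∈ S.powerset, ((insert i T).card = 1 ↔ T = ∅) := by
    intro T hT
    rw [Finset.card_insert_of_notMem fun h => hi (Finset.mem_powerset.1 hT h)]
    simp
  rw [hL]
  simp_rw [hexp]
  rw [integral_finsetSum _ fun T _ => (hint _).const_mul _]
  simp_rw [integral_const_mul, add_mul]
  rw [Finset.sum_add_distrib, Finset.mul_sum]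
  congr 1
  · rw [Finset.sum_eq_single ∅]
    · simp
    · intro T hT hne
      rw [if_neg (fun h => hne ((hcard T hT).1 h)), zero_mul]
    · intro h
      exact absurd (Finset.empty_mem_powerset _) h
  · exact Finset.sum_congr rfl fun T _ => by ring

/-- The sum of the values of all graphs is a moment of the compound Poisson distribution. -/
lemma sum_value_eq_moment (hR0 : 0 ≤ R) (hR : ∀ᵐ y ∂r, ‖y‖ ≤ R) (a : Space d) {z t : ℝ}
    {l : ℝ≥0} (hl : (l : ℝ) = z * t) (φ : Space d) (m : ℕ) :
    ∑ G : QGraph m, G.value a z r t φ =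
      ∫ x, (‖t • a - φ + x‖ ^ 2) ^ m ∂compoundPoisson l r := by
  simp only [QGraph.value]
  rw [Finset.sum_comm]
  have h1 (X : Fin m → Fin d) : ∑ G : QGraph m, (∏ v ∈ G.outer, ∏ h ∈ v, -φ (X h.1)) *
      ∏ v ∈ G.inner, t * coeffC a z r (fun i : Fin v.card => X (v.equivFin.symm i).1.1) =
      ∫ x, ∏ h : Leg m, (t • a - φ + x) (X h.1) ∂compoundPoisson l r := by
    rw [sum_qGraph_eq_sum_finpartition m (fun v => ∏ h ∈ v, -φ (X h.1))
      (fun v => t * coeffC a z r (fun i : Fin v.card => X (v.equivFin.symm i).1.1))]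
    have h2 := moment_eq_sum_finpartition
      (fun B : Finset (Leg m) => (if B.card = 1 then ∏ h ∈ B, (t • a - φ) (X h.1) else 0) +
        l * ∫ y, ∏ h ∈ B, y (X h.1) ∂r)
      (fun S => ∫ x, ∏ h ∈ S, (t • a - φ + x) (X h.1) ∂compoundPoisson l r) (by simp)
      (fun i S hi => moment_insert hR0 hR l (t • a - φ) (fun h : Leg m => X h.1) i S hi)
      Finset.univ
    rw [h2]
    -- A one-leg block may be outer, with weight `-φ`, or inner, with weight `t C`. The sum of both
    -- is the first cumulant of `t • a - φ + x`; larger blocks are inner and have cumulant `z t`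
    -- times a moment of `r`.
    refine Finset.sum_congr rfl fun π _ => Finset.prod_congr rfl fun v hv => ?_
    rw [coeffC_vertex hR0 hR a z X v (π.nonempty_of_mem_parts hv), hl]
    split_ifs with hc
    · obtain ⟨h, rfl⟩ := Finset.card_eq_one.1 hc
      simp only [Finset.prod_singleton, PiLp.sub_apply, PiLp.smul_apply, smul_eq_mul]
      ring
    · ring
  simp_rw [h1]
  rw [← integral_finsetSum]
  · congr 1 with x
    -- Both legs of an edge carry the same index, hence the squares; summing over the indices builds
    -- the powers of the squared norm.
    have h3 (X : Fin m → Fin d) : ∏ h : Leg m, (t • a - φ + x) (X h.1) =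
        ∏ j : Fin m, (t • a - φ + x) (X j) ^ 2 := by
      rw [Fintype.prod_prod_type]
      simp [sq]
    simp_rw [h3]
    rw [EuclideanSpace.real_norm_sq_eq, Finset.sum_pow', Fintype.piFinset_univ]
  · intro X _
    exact (ExpBounded.prod Finset.univ fun h : Leg m =>
      (expBounded_coord (X h.1)).comp_add (t • a - φ)).integrable_compoundPoisson hR l

end Cumulants

open FourierTransform

/-! ### The adjoint generator as a Fourier multiplier -/

section Generator

variable {d : ℕ}

/-- The plane wave `exp (2πi ⟨ξ, x⟩)`. -/
noncomputable def wave (ξ x : Space d) : ℂ :=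
  Complex.exp (((2 * Real.pi * inner ℝ ξ x : ℝ) : ℂ) * Complex.I)

lemma norm_wave (ξ x : Space d) : ‖wave ξ x‖ = 1 := Complex.norm_exp_ofReal_mul_I _

lemma continuous_wave : Continuous fun p : Space d × Space d => wave p.1 p.2 := by
  unfold wave
  fun_prop

lemma continuous_wave_left (x : Space d) : Continuous fun ξ : Space d => wave ξ x := by
  unfold wave
  fun_prop

lemma continuous_wave_right (ξ : Space d) : Continuous fun x : Space d => wave ξ x := by
  unfold wave
  fun_prop

lemma wave_add (ξ x y : Space d) : wave ξ (x + y) = wave ξ x * wave ξ y := by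
  rw [wave, wave, wave, ← Complex.exp_add, inner_add_right]
  push_cast
  ring_nf

lemma integral_wave (r : Measure (Space d)) (ξ : Space d) :
    ∫ y, wave ξ y ∂r = charFun r ((2 * Real.pi) • ξ) := by
  rw [charFun_apply]
  congr 1 with y
  rw [wave, inner_smul_right, real_inner_comm]

lemma fourierInv_apply_eq_integral_wave (f : 𝓢(Space d, ℂ)) (x : Space d) :
    (𝓕⁻ f) x = ∫ ξ, wave ξ x * f ξ := by
  rw [SchwartzMap.fourierInv_coe, Real.fourierInv_eq']
  rfl

lemma eq_integral_wave_mul_fourier (g : 𝓢(Space d, ℂ)) (x : Space d) :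
    g x = ∫ ξ, wave ξ x * (𝓕 g) ξ := by
  rw [← fourierInv_apply_eq_integral_wave, FourierTransform.fourierInv_fourier_eq]

lemma integrable_wave_mul {k : Space d → ℂ} (hk : Integrable k) (x : Space d) :
    Integrable fun ξ => wave ξ x * k ξ :=
  hk.bdd_mul (continuous_wave_left x).aestronglyMeasurable
    (ae_of_all _ fun ξ => (norm_wave ξ x).le)

/-- The Lévy-Khinchine exponent at frequency `ξ`. -/
noncomputable def exponent (a : Space d) (z μ : ℝ) (r : Measure (Space d)) (ξ : Space d) : ℂ :=
  -((μ * (2 * Real.pi) ^ 2 * ‖ξ‖ ^ 2 : ℝ) : ℂ) +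
    ((2 * Real.pi * inner ℝ ξ a : ℝ) : ℂ) * Complex.I +
    (z : ℂ) * (charFun r ((2 * Real.pi) • ξ) - 1)

variable (a : Space d) (z μ : ℝ) (r : Measure (Space d)) [IsProbabilityMeasure r]

/-- Integrability accompanies the formula here and in the next two lemmas so that
`adjointGenerator_eq` can add the three parts under one integral. -/
lemma laplacian_eq_integral_wave (g : 𝓢(Space d, ℂ)) (x : Space d) :
    Integrable (fun ξ : Space d => ((‖ξ‖ ^ 2 : ℝ) : ℂ) * (𝓕 g) ξ) ∧
    (Δ (g : Space d → ℂ)) x =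
      ∫ ξ, wave ξ x * (-(((2 * Real.pi) ^ 2 : ℝ) : ℂ) * (((‖ξ‖ ^ 2 : ℝ) : ℂ) * (𝓕 g) ξ)) := by
  have hg : (fun ξ : Space d => ‖ξ‖ ^ 2).HasTemperateGrowth := by fun_prop
  have hf (ξ : Space d) : SchwartzMap.smulLeftCLM ℂ (fun ξ : Space d => ‖ξ‖ ^ 2) (𝓕 g) ξ =
      ((‖ξ‖ ^ 2 : ℝ) : ℂ) * (𝓕 g) ξ := by
    rw [SchwartzMap.smulLeftCLM_apply_apply hg, Complex.real_smul]
  constructor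
  · exact (SchwartzMap.integrable _).congr (ae_of_all _ hf)
  · rw [← SchwartzMap.laplacian_apply, SchwartzMap.laplacian_eq_fourierMultiplierCLM,
      smul_apply, SchwartzMap.fourierMultiplierCLM_apply,
      fourierInv_apply_eq_integral_wave, Complex.real_smul, ← integral_const_mul]
    congr 1 with ξ
    rw [show ((‖·‖ ^ 2 : Space d → ℝ)) = fun ξ : Space d => ‖ξ‖ ^ 2 from rfl, hf]
    push_cast
    ring

lemma fderiv_eq_integral_wave (g : 𝓢(Space d, ℂ)) (x : Space d) :
    Integrable (fun ξ : Space d => ((inner ℝ ξ a : ℝ) : ℂ) * (𝓕 g) ξ) ∧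
    fderiv ℝ (g : Space d → ℂ) x a =
      ∫ ξ, wave ξ x * ((2 * Real.pi * Complex.I) * (((inner ℝ ξ a : ℝ) : ℂ) * (𝓕 g) ξ)) := by
  have hg : (fun ξ : Space d => inner ℝ ξ a).HasTemperateGrowth := by fun_prop
  have hf (ξ : Space d) : SchwartzMap.smulLeftCLM ℂ (fun ξ : Space d => inner ℝ ξ a) (𝓕 g) ξ =
      ((inner ℝ ξ a : ℝ) : ℂ) * (𝓕 g) ξ := by
    rw [SchwartzMap.smulLeftCLM_apply_apply hg, Complex.real_smul]
  constructor
  · exact (SchwartzMap.integrable _).congr (ae_of_all _ hf)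
  · have h1 : fderiv ℝ (g : Space d → ℂ) x a = (LineDeriv.lineDerivOp a g) x := rfl
    rw [h1, SchwartzMap.lineDeriv_eq_fourierMultiplierCLM,
      smul_apply, SchwartzMap.fourierMultiplierCLM_apply,
      fourierInv_apply_eq_integral_wave, smul_eq_mul, ← integral_const_mul]
    congr 1 with ξ
    rw [hf]
    ring

/-- A shift by `y` multiplies the plane wave by `wave ξ y`, and averaging over `y` by Fubini
produces the characteristic function. -/
lemma integral_jump_eq_integral_wave (g : 𝓢(Space d, ℂ)) (x : Space d) :
    Integrable (fun ξ : Space d => (charFun r ((2 * Real.pi) • ξ) - 1) * (𝓕 g) ξ) ∧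
    ∫ y, (g (x + y) - g x) ∂r =
      ∫ ξ, wave ξ x * ((charFun r ((2 * Real.pi) • ξ) - 1) * (𝓕 g) ξ) := by
  have hint : Integrable fun ξ => (𝓕 g) ξ := (𝓕 g).integrable
  have hm : Measurable fun ξ : Space d => charFun r ((2 * Real.pi) • ξ) - 1 := by fun_prop
  constructor
  · refine hint.bdd_mul (c := 2) hm.aestronglyMeasurable (ae_of_all _ fun ξ => ?_)
    rw [norm_sub_rev]
    exact norm_one_sub_charFun_le_two
  · have h1 (y : Space d) : g (x + y) - g x = ∫ ξ, (wave ξ y - 1) * (wave ξ x * (𝓕 g) ξ) := by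
      rw [eq_integral_wave_mul_fourier g (x + y), eq_integral_wave_mul_fourier g x,
        ← integral_sub (integrable_wave_mul hint _) (integrable_wave_mul hint _)]
      congr 1 with ξ
      rw [wave_add]
      ring
    have h2 : Integrable (Function.uncurry fun (y : Space d) (ξ : Space d) =>
        (wave ξ y - 1) * (wave ξ x * (𝓕 g) ξ)) (r.prod volume) := by
      have h3 : Integrable (fun p : Space d × Space d => wave p.2 x * (𝓕 g) p.2)
          (r.prod volume) := (integrable_wave_mul hint x).comp_snd r
      refine h3.bdd_mul (c := 2) ?_ (ae_of_all _ fun p => ?_)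
      · exact ((continuous_wave.comp continuous_swap).sub continuous_const).aestronglyMeasurable
      · refine (norm_sub_le _ _).trans ?_
        rw [norm_wave, norm_one]
        norm_num
    simp_rw [h1]
    rw [integral_integral_swap h2]
    congr 1 with ξ
    have hw : Integrable (fun y => wave ξ y) r :=
      Integrable.of_bound (continuous_wave_right ξ).aestronglyMeasurable 1
        (ae_of_all _ fun y => (norm_wave ξ y).le)
    rw [integral_mul_const, integral_sub hw (integrable_const _), integral_wave]
    simp only [integral_const, probReal_univ, one_smul]
    ring

/-- The adjoint generator is the Fourier multiplier with the Lévy-Khinchine exponent. -/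
lemma adjointGenerator_eq (g : 𝓢(Space d, ℂ)) (x : Space d) :
    Integrable (fun ξ => exponent a z μ r ξ * (𝓕 g) ξ) ∧
    adjointGenerator a z μ r g x = ∫ ξ, wave ξ x * (exponent a z μ r ξ * (𝓕 g) ξ) := by
  obtain ⟨i1, e1⟩ := laplacian_eq_integral_wave g x
  obtain ⟨i2, e2⟩ := fderiv_eq_integral_wave a g x
  obtain ⟨i3, e3⟩ := integral_jump_eq_integral_wave r g x
  have j1 := (i1.const_mul (-(((2 * Real.pi) ^ 2 : ℝ) : ℂ)))
  have j2 := (i2.const_mul (2 * Real.pi * Complex.I))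
  constructor
  · refine (((j1.const_mul (μ : ℂ)).add j2).add (i3.const_mul (z : ℂ))).congr
      (ae_of_all _ fun ξ => ?_)
    simp only [exponent, Pi.add_apply]
    push_cast
    ring
  · have k1 := (integrable_wave_mul j1 x).const_mul (μ : ℂ)
    have k2 := integrable_wave_mul j2 x
    have k3 := (integrable_wave_mul i3 x).const_mul (z : ℂ)
    rw [adjointGenerator, e1, e2, e3, ← integral_const_mul, ← integral_const_mul,
      ← integral_add k1 k2]
    refine (integral_add (k1.add k2) k3).symm.trans ?_
    congr 1 with ξ
    simp only [exponent, Pi.add_apply]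
    push_cast
    ring

/-- Since `|charFun r| ≤ 1`, the jump part can only damp. The resulting bound `|exp (s * exponent)|
≤ 1` dominates all later limits in time. -/
lemma exponent_re_nonpos {z μ : ℝ} (hz : 0 ≤ z) (hμ : 0 ≤ μ) (ξ : Space d) :
    (exponent a z μ r ξ).re ≤ 0 := by
  have h1 : (charFun r ((2 * Real.pi) • ξ)).re ≤ 1 :=
    (Complex.re_le_norm _).trans (norm_charFun_le_one _)
  have h2 : 0 ≤ μ * (2 * Real.pi) ^ 2 * ‖ξ‖ ^ 2 := by positivity
  have h3 : z * ((charFun r ((2 * Real.pi) • ξ)).re - 1) ≤ 0 :=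
    mul_nonpos_of_nonneg_of_nonpos hz (by linarith)
  rw [exponent, Complex.add_re, Complex.add_re, Complex.neg_re, Complex.ofReal_re,
    Complex.re_ofReal_mul, Complex.re_ofReal_mul, Complex.sub_re, Complex.one_re, Complex.I_re]
  linarith

lemma norm_exp_mul_exponent_le {z μ s : ℝ} (hz : 0 ≤ z) (hμ : 0 ≤ μ) (hs : 0 ≤ s)
    (ξ : Space d) : ‖Complex.exp (s * exponent a z μ r ξ)‖ ≤ 1 := by
  rw [Complex.norm_exp, Complex.re_ofReal_mul, Real.exp_le_one_iff]
  exact mul_nonpos_of_nonneg_of_nonpos hs (exponent_re_nonpos a r hz hμ ξ)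

lemma measurable_exponent : Measurable (exponent a z μ r) := by
  unfold exponent
  fun_prop

end Generator

/-! ### Existence: the Gaussian mixture solves the evolution equation -/

section Density

variable {d : ℕ} (a : Space d) (z μ : ℝ) (r : Measure (Space d)) [IsProbabilityMeasure r]

/-- The density of the Lévy process: a Gaussian convolved with a compound Poisson law. -/
noncomputable def levyDensity (a : Space d) (z μ : ℝ) (r : Measure (Space d)) (t : ℝ)
    (x : Space d) : ℝ :=
  (1 / (4 * μ * t) / Real.pi) ^ ((d : ℝ) / 2) *
    ∫ y, Real.exp (-(1 / (4 * μ * t)) * ‖t • a - x + y‖ ^ 2) ∂compoundPoisson (z * t).toNNReal r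

variable {μ} {t : ℝ}

omit [IsProbabilityMeasure r] in
lemma levyDensity_nonneg (hμ : 0 < μ) (ht : 0 < t) (x : Space d) :
    0 ≤ levyDensity a z μ r t x :=
  mul_nonneg (by positivity) (integral_nonneg fun _ => (Real.exp_pos _).le)

lemma norm_exp_neg_mul_sq_le {b : ℝ} (hb : 0 < b) (x : Space d) :
    ‖Real.exp (-b * ‖x‖ ^ 2)‖ ≤ 1 := by
  rw [Real.norm_eq_abs, Real.abs_exp, Real.exp_le_one_iff]
  nlinarith [sq_nonneg ‖x‖]

lemma continuous_levyDensity (hμ : 0 < μ) (ht : 0 < t) : Continuous (levyDensity a z μ r t) := by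
  refine continuous_const.mul (continuous_of_dominated (bound := fun _ => 1)
    (fun x => ?_) (fun x => ?_) (integrable_const _) (ae_of_all _ fun y => ?_))
  · exact (by fun_prop : Continuous _).aestronglyMeasurable
  · exact ae_of_all _ fun y => norm_exp_neg_mul_sq_le (by positivity) _
  · fun_prop

lemma integral_gaussian_mul_wave {b : ℝ} (hb : 0 < b) (c ξ : Space d) :
    Integrable (fun x : Space d => Real.exp (-b * ‖c - x‖ ^ 2)) ∧
    ∫ x : Space d, (Real.exp (-b * ‖c - x‖ ^ 2) : ℂ) * wave ξ x =
      ((Real.pi / b) ^ ((d : ℝ) / 2) : ℝ) *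
        (wave ξ c * Complex.exp (-(((2 * Real.pi) ^ 2 * ‖ξ‖ ^ 2 / (4 * b) : ℝ) : ℂ))) := by
  constructor
  · have h := GaussianFourier.integrable_cexp_neg_mul_sq_norm_add (V := Space d) (b := (b : ℂ))
      (by simpa using hb) 0 0
    have h2 : Integrable fun x : Space d => Real.exp (-b * ‖x‖ ^ 2) := by
      refine h.re.congr (ae_of_all _ fun x => ?_)
      simp only [zero_mul, add_zero]
      rw [← Complex.exp_ofReal_re]
      push_cast
      rfl
    exact h2.comp_sub_left c
  · rw [← integral_sub_left_eq_self _ volume c]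
    simp only [sub_sub_cancel]
    have h1 (x : Space d) : (Real.exp (-b * ‖x‖ ^ 2) : ℂ) * wave ξ (c - x) =
        wave ξ c * Complex.exp (-b * ‖x‖ ^ 2 + (-(2 * Real.pi * Complex.I)) * inner ℝ ξ x) := by
      rw [sub_eq_add_neg, wave_add, wave, wave, Complex.ofReal_exp, ← Complex.exp_add,
        ← Complex.exp_add, ← Complex.exp_add, inner_neg_right]
      push_cast
      ring_nf
    simp_rw [h1]
    rw [integral_const_mul, GaussianFourier.integral_cexp_neg_mul_sq_norm_add
      (by simpa using hb), finrank_euclideanSpace_fin, Complex.ofReal_cpow (by positivity)]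
    have h2 : (-(2 * Real.pi * Complex.I)) ^ 2 * (‖ξ‖ : ℂ) ^ 2 / (4 * b) =
        -(((2 * Real.pi) ^ 2 * ‖ξ‖ ^ 2 / (4 * b) : ℝ) : ℂ) := by
      push_cast
      rw [neg_sq, mul_pow, Complex.I_sq]
      ring
    rw [h2]
    push_cast
    ring

/-- By translation invariance the integral over the first variable does not depend on the second, so
Tonelli applies. -/
lemma integrable_gaussian_prod {b : ℝ} (hb : 0 < b) (c : Space d) (ν : Measure (Space d))
    [IsProbabilityMeasure ν] :
    Integrable (fun p : Space d × Space d => Real.exp (-b * ‖c - p.1 + p.2‖ ^ 2))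
      (volume.prod ν) := by
  rw [integrable_prod_iff' (by fun_prop)]
  have h (y x : Space d) : c - x + y = c + y - x := by abel
  constructor
  · refine ae_of_all _ fun y => ?_
    simp_rw [h]
    exact (integral_gaussian_mul_wave hb (c + y) 0).1
  · have h2 (y : Space d) : ∫ x : Space d, ‖Real.exp (-b * ‖c - x + y‖ ^ 2)‖ =
        ∫ x : Space d, Real.exp (-b * ‖x‖ ^ 2) := by
      simp_rw [h, Real.norm_eq_abs, Real.abs_exp]
      exact integral_sub_left_eq_self (fun x : Space d => Real.exp (-b * ‖x‖ ^ 2)) volume (c + y)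
    simp_rw [h2]
    exact integrable_const _

lemma integrable_levyDensity (hμ : 0 < μ) (ht : 0 < t) :
    Integrable (levyDensity a z μ r t) :=
  (integrable_gaussian_prod (by positivity) (t • a) _).integral_prod_left.const_mul _

/-- The Fourier transform of the density. -/
lemma integral_levyDensity_mul_wave {z : ℝ} (hz : 0 ≤ z) (hμ : 0 < μ) (ht : 0 < t)
    (ξ : Space d) :
    ∫ x, (levyDensity a z μ r t x : ℂ) * wave ξ x =
      Complex.exp (t * exponent a z μ r ξ) := by
  set b : ℝ := 1 / (4 * μ * t) with hb
  have hb0 : 0 < b := by positivity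
  set ν := compoundPoisson (z * t).toNNReal r with hν
  have hI := integrable_gaussian_prod hb0 (t • a) ν
  have hI2 : Integrable (fun p : Space d × Space d =>
      (Real.exp (-b * ‖t • a - p.1 + p.2‖ ^ 2) : ℂ) * wave ξ p.1) (volume.prod ν) :=
    hI.ofReal.mul_bdd (c := 1) ((continuous_wave_right ξ).comp continuous_fst).aestronglyMeasurable
      (ae_of_all _ fun p => (norm_wave ξ p.1).le)
  have h1 (x : Space d) : (levyDensity a z μ r t x : ℂ) * wave ξ x =
      ((b / Real.pi) ^ ((d : ℝ) / 2) : ℝ) *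
        ∫ y, (Real.exp (-b * ‖t • a - x + y‖ ^ 2) : ℂ) * wave ξ x ∂ν := by
    rw [levyDensity, integral_mul_const, integral_complex_ofReal]
    push_cast
    ring
  simp_rw [h1]
  rw [integral_const_mul, integral_integral_swap hI2]
  have h2 (y x : Space d) : t • a - x + y = t • a + y - x := by abel
  simp_rw [h2, (integral_gaussian_mul_wave hb0 _ ξ).2]
  simp_rw [wave_add]
  rw [integral_const_mul, integral_mul_const, integral_const_mul, integral_wave, hν,
    charFun_compoundPoisson, ← mul_assoc, ← Complex.ofReal_mul,
    ← Real.mul_rpow (by positivity) (by positivity)]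
  have h3 : b / Real.pi * (Real.pi / b) = 1 := by field_simp
  rw [h3, Real.one_rpow, Complex.ofReal_one, one_mul, wave, ← Complex.exp_add,
    ← Complex.exp_add]
  congr 1
  have h4 : (((z * t).toNNReal : ℝ) : ℂ) = z * t := by
    rw [Real.coe_toNNReal _ (by positivity)]
    push_cast
    rfl
  have h5 : (2 * Real.pi) ^ 2 * ‖ξ‖ ^ 2 / (4 * b) = t * (μ * (2 * Real.pi) ^ 2 * ‖ξ‖ ^ 2) := by
    rw [hb]
    field_simp
  rw [h4, h5, exponent, inner_smul_right]
  push_cast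
  ring

lemma integral_levyDensity {z : ℝ} (hz : 0 ≤ z) (hμ : 0 < μ) (ht : 0 < t) :
    ∫ x, levyDensity a z μ r t x = 1 := by
  have h := integral_levyDensity_mul_wave a r hz hμ ht 0
  simp only [wave, exponent, inner_zero_left, mul_zero, smul_zero, charFun_zero,
    norm_zero, Complex.ofReal_zero, zero_mul, Complex.exp_zero, mul_one, probReal_univ] at h
  rw [integral_complex_ofReal] at h
  have : ((∫ x, levyDensity a z μ r t x : ℝ) : ℂ) = ((1 : ℝ) : ℂ) := by
    rw [h]
    simp
  exact_mod_cast this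

/-- Parseval's identity for the density. -/
lemma integral_levyDensity_mul {z : ℝ} (hz : 0 ≤ z) (hμ : 0 < μ) (ht : 0 < t)
    {k : Space d → ℂ} (hk : Integrable k) :
    ∫ x, (levyDensity a z μ r t x : ℂ) * ∫ ξ, wave ξ x * k ξ =
      ∫ ξ, Complex.exp (t * exponent a z μ r ξ) * k ξ := by
  have hI := ((integrable_levyDensity a z r hμ ht).ofReal (𝕜 := ℂ)).mul_prod hk
  have hI2 : Integrable (Function.uncurry fun x ξ : Space d =>
      (levyDensity a z μ r t x : ℂ) * (wave ξ x * k ξ)) (volume.prod volume) := by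
    refine (hI.bdd_mul (c := 1) (continuous_wave.comp continuous_swap).aestronglyMeasurable
      (ae_of_all _ fun p => (norm_wave p.2 p.1).le)).congr (ae_of_all _ fun p => ?_)
    simp only [Function.uncurry, Function.comp, Prod.fst_swap, Prod.snd_swap, Complex.coe_algebraMap]
    ring
  simp_rw [← integral_const_mul]
  rw [integral_integral_swap hI2]
  congr 1 with ξ
  simp_rw [← mul_assoc]
  rw [integral_mul_const, integral_levyDensity_mul_wave a r hz hμ ht]

lemma integral_levyDensity_mul_schwartz {z : ℝ} (hz : 0 ≤ z) (hμ : 0 < μ) (ht : 0 < t)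
    (g : 𝓢(Space d, ℂ)) :
    ∫ x, (levyDensity a z μ r t x : ℂ) * g x =
      ∫ ξ, Complex.exp (t * exponent a z μ r ξ) * (𝓕 g) ξ := by
  rw [← integral_levyDensity_mul a r hz hμ ht (𝓕 g).integrable]
  simp_rw [← eq_integral_wave_mul_fourier]

lemma aestronglyMeasurable_exp_exponent (z μ s : ℝ) :
    AEStronglyMeasurable (fun ξ => Complex.exp (s * exponent a z μ r ξ)) volume :=
  (Complex.measurable_exp.comp
    ((measurable_exponent a z μ r).const_mul _)).aestronglyMeasurable

lemma norm_exp_exponent_mul_le {z μ s : ℝ} (hz : 0 ≤ z) (hμ : 0 ≤ μ) (hs : 0 ≤ s)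
    (ξ : Space d) (w : ℂ) : ‖Complex.exp (s * exponent a z μ r ξ) * w‖ ≤ ‖w‖ := by
  rw [norm_mul]
  exact mul_le_of_le_one_left (norm_nonneg _) (norm_exp_mul_exponent_le a r hz hμ hs ξ)

lemma hasDerivAt_integral_exp_exponent {z : ℝ} (hz : 0 ≤ z) (hμ : 0 < μ) (ht : 0 < t)
    {k : Space d → ℂ} (hk : Integrable k) (hk' : Integrable fun ξ => exponent a z μ r ξ * k ξ) :
    HasDerivAt (fun s : ℝ => ∫ ξ, Complex.exp (s * exponent a z μ r ξ) * k ξ)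
      (∫ ξ, Complex.exp (t * exponent a z μ r ξ) * (exponent a z μ r ξ * k ξ)) t := by
  have hme := aestronglyMeasurable_exp_exponent a r z μ
  refine (hasDerivAt_integral_of_dominated_loc_of_deriv_le
    (F := fun (s : ℝ) ξ => Complex.exp (s * exponent a z μ r ξ) * k ξ)
    (F' := fun (s : ℝ) ξ => Complex.exp (s * exponent a z μ r ξ) * (exponent a z μ r ξ * k ξ))
    (bound := fun ξ => ‖exponent a z μ r ξ * k ξ‖) (lt_mem_nhds ht)
    (Eventually.of_forall fun s => (hme s).mul hk.aestronglyMeasurable)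
    ?_ ?_ ?_ hk'.norm ?_).2
  · exact hk.bdd_mul (c := 1) (hme t) (ae_of_all _ fun ξ =>
      norm_exp_mul_exponent_le a r hz hμ.le ht.le ξ)
  · exact (hme t).mul hk'.aestronglyMeasurable
  · exact ae_of_all _ fun ξ s hs => norm_exp_exponent_mul_le a r hz hμ.le (le_of_lt hs) ξ _
  · refine ae_of_all _ fun ξ s _ => ?_
    have h3 : HasDerivAt (fun s : ℝ => (s : ℂ) * exponent a z μ r ξ) (exponent a z μ r ξ) s := by
      simpa using (Complex.ofRealCLM.hasDerivAt (x := s)).mul_const (exponent a z μ r ξ)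
    have h4 := h3.cexp.mul_const (k ξ)
    rwa [mul_assoc] at h4

lemma tendsto_integral_exp_exponent {z : ℝ} (hz : 0 ≤ z) (hμ : 0 < μ)
    {k : Space d → ℂ} (hk : Integrable k) :
    Tendsto (fun s : ℝ => ∫ ξ, Complex.exp (s * exponent a z μ r ξ) * k ξ) (𝓝[>] 0)
      (𝓝 (∫ ξ, k ξ)) := by
  refine tendsto_integral_filter_of_dominated_convergence (fun ξ => ‖k ξ‖)
    (Eventually.of_forall fun s =>
      (aestronglyMeasurable_exp_exponent a r z μ s).mul hk.aestronglyMeasurable)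
    ?_ hk.norm (ae_of_all _ fun ξ => ?_)
  · filter_upwards [self_mem_nhdsWithin] with s hs
    exact ae_of_all _ fun ξ => norm_exp_exponent_mul_le a r hz hμ.le (le_of_lt hs) ξ _
  · have h3 : Continuous fun s : ℝ => Complex.exp (s * exponent a z μ r ξ) * k ξ := by
      fun_prop
    have h4 := (h3.tendsto 0).mono_left (nhdsWithin_le_nhds (s := Ioi 0))
    simpa using h4

lemma isLevyDensity_levyDensity {z : ℝ} (hz : 0 ≤ z) (hμ : 0 < μ) :
    IsLevyDensity a z μ r (levyDensity a z μ r) where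
  nonneg t ht x := levyDensity_nonneg a z r hμ ht x
  continuous t ht := continuous_levyDensity a z r hμ ht
  integrable t ht := integrable_levyDensity a z r hμ ht
  integral_eq_one t ht := integral_levyDensity a r hz hμ ht
  equation g t ht := by
    have hik := (adjointGenerator_eq a z μ r g 0).1
    simp_rw [(adjointGenerator_eq a z μ r g _).2]
    -- Parseval is applied to `exponent * 𝓕 g`, for which integrability is enough; smoothness of the
    -- exponent is not involved.
    rw [integral_levyDensity_mul a r hz hμ ht hik]
    refine (hasDerivAt_integral_exp_exponent a r hz hμ ht (𝓕 g).integrable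
      hik).congr_of_eventuallyEq ?_
    filter_upwards [lt_mem_nhds ht] with s hs
    exact integral_levyDensity_mul_schwartz a r hz hμ hs g
  initial g := by
    have h2 : g 0 = ∫ ξ, (𝓕 g) ξ := by
      rw [eq_integral_wave_mul_fourier g 0]
      simp [wave]
    rw [h2]
    refine (tendsto_integral_exp_exponent a r hz hμ (𝓕 g).integrable).congr' ?_
    filter_upwards [self_mem_nhdsWithin] with s hs
    exact (integral_levyDensity_mul_schwartz a r hz hμ hs g).symm

end Density

open scoped ContDiff

/-! ### Uniqueness of the density -/

section Uniqueness

/-- A sequence of functions on `(0, ∞)` with `D n' = D (n + 1)`, geometric bounds and vanishing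
initial values is zero. -/
lemma eq_zero_of_hasDerivAt_succ {E : Type*} [NormedAddCommGroup E] [NormedSpace ℝ E]
    {D : ℕ → ℝ → E} {K M : ℝ}
    (hD : ∀ n s, 0 < s → HasDerivAt (D n) (D (n + 1) s) s)
    (h0 : ∀ n, Tendsto (D n) (𝓝[>] 0) (𝓝 0))
    (hb : ∀ n s, 0 < s → ‖D n s‖ ≤ K * M ^ n) {t : ℝ} (ht : 0 < t) : D 0 t = 0 := by
  -- Integrating `k` times from `0`, where every `D n` vanishes, gains the factor `s ^ k / k!`,
  -- which beats `M ^ k` as `k → ∞`.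
  have key : ∀ k n s, 0 < s → ‖D n s‖ ≤ K * M ^ (n + k) * (s ^ k / k.factorial) := by
    intro k
    induction k with
    | zero => simpa using hb
    | succ k ih =>
      intro n s hs
      have hB (u : ℝ) : HasDerivAt
          (fun u : ℝ => K * M ^ (n + (k + 1)) * (u ^ (k + 1) / (k + 1).factorial))
          (K * M ^ (n + 1 + k) * (u ^ k / k.factorial)) u := by
        have h := ((hasDerivAt_pow (k + 1) u).div_const ((k + 1).factorial : ℝ)).const_mul
          (K * M ^ (n + (k + 1)))
        refine h.congr_deriv ?_
        rw [Nat.factorial_succ, show n + (k + 1) = n + 1 + k by ring]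
        push_cast
        field_simp
      -- The functions are controlled at `0` only through their limits, so the comparison starts at
      -- `ε` and then `ε → 0`.
      have hle : ∀ ε ∈ Ioo 0 s, ‖D n s - D n ε‖ ≤
          K * M ^ (n + (k + 1)) * (s ^ (k + 1) / (k + 1).factorial) := by
        intro ε hε
        have hpos : ∀ u ∈ Icc ε s, 0 < u := fun u hu => hε.1.trans_le hu.1
        refine image_norm_le_of_norm_deriv_right_le_deriv_boundary
          (f := fun u => D n u - D n ε) (f' := D (n + 1)) (a := ε) (b := s)
          (fun u hu => ?_) (fun u hu => ?_) ?_ hB (fun u hu => ?_)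
          (right_mem_Icc.2 hε.2.le)
        · exact ((hD n u (hpos u hu)).continuousAt.sub continuousAt_const).continuousWithinAt
        · exact ((hD n u (hpos u (Ico_subset_Icc_self hu))).sub_const _).hasDerivWithinAt
        · rw [sub_self, norm_zero]
          have := (norm_nonneg _).trans (ih (n + 1) ε hε.1)
          have h2 : 0 ≤ K * M ^ (n + 1 + k) := by
            refine nonneg_of_mul_nonneg_left this ?_
            have := hε.1
            positivity
          rw [show n + (k + 1) = n + 1 + k by ring]
          have := hε.1
          positivity
        · exact ih (n + 1) u (hpos u (Ico_subset_Icc_self hu))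
      have hlim : Tendsto (fun ε => ‖D n s - D n ε‖) (𝓝[>] 0) (𝓝 ‖D n s - 0‖) :=
        (tendsto_const_nhds.sub (h0 n)).norm
      rw [sub_zero] at hlim
      refine le_of_tendsto hlim ?_
      filter_upwards [Ioo_mem_nhdsGT hs] with ε hε using hle ε hε
  have hlim : Tendsto (fun k : ℕ => K * ((M * t) ^ k / k.factorial)) atTop (𝓝 (K * 0)) :=
    (FloorSemiring.tendsto_pow_div_factorial_atTop (M * t)).const_mul K
  rw [mul_zero] at hlim
  have h1 : ‖D 0 t‖ ≤ 0 := by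
    refine ge_of_tendsto' hlim fun k => (key k 0 t ht).trans_eq ?_
    rw [zero_add, mul_pow]
    ring
  simpa using h1

variable {d : ℕ} (a : Space d) (z μ : ℝ) (r : Measure (Space d)) [IsProbabilityMeasure r]

/-- Bounded jumps have all moments, so the characteristic function is smooth. Hence multiplication
by the exponent preserves smooth functions of compact support. -/
lemma contDiff_exponent {R : ℝ} (hR : ∀ᵐ y ∂r, ‖y‖ ≤ R) :
    ContDiff ℝ ∞ (exponent a z μ r) := by
  have h1 : ContDiff ℝ ∞ (charFun r) :=
    contDiff_charFun' fun k => MemLp.of_bound (by fun_prop) R hR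
  have h2 : ContDiff ℝ ∞ fun ξ : Space d => ((μ * (2 * Real.pi) ^ 2 * ‖ξ‖ ^ 2 : ℝ) : ℂ) :=
    Complex.ofRealCLM.contDiff.comp (contDiff_const.mul (contDiff_norm_sq ℝ))
  have h3 : ContDiff ℝ ∞ fun ξ : Space d => ((2 * Real.pi * inner ℝ ξ a : ℝ) : ℂ) :=
    Complex.ofRealCLM.contDiff.comp (contDiff_const.mul (contDiff_id.inner ℝ contDiff_const))
  have h4 : ContDiff ℝ ∞ fun ξ : Space d => charFun r ((2 * Real.pi) • ξ) :=
    h1.comp (contDiff_const_smul _)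
  unfold exponent
  exact ContDiff.add (ContDiff.add (ContDiff.neg h2) (ContDiff.mul h3 contDiff_const))
    (ContDiff.mul contDiff_const (ContDiff.sub h4 contDiff_const))

lemma wave_comm (ξ x : Space d) : wave ξ x = wave x ξ := by
  rw [wave, wave, real_inner_comm]

/-- A continuous integrable function is zero if it annihilates the Fourier transforms of all test
functions. -/
lemma eq_zero_of_integral_mul_wave_eq_zero {f : Space d → ℂ} (hf : Integrable f)
    (hc : Continuous f)
    (h : ∀ g : Space d → ℝ, ContDiff ℝ ∞ g → HasCompactSupport g →
      ∫ x, f x * ∫ ξ, wave ξ x * (g ξ : ℂ) = 0) : f = 0 := by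
  have hχ : Continuous fun ξ => ∫ x, f x * wave ξ x := by
    refine continuous_of_dominated (bound := fun x => ‖f x‖)
      (fun ξ => hf.aestronglyMeasurable.mul (continuous_wave_right ξ).aestronglyMeasurable)
      (fun ξ => ae_of_all _ fun x => ?_) hf.norm
      (ae_of_all _ fun x => continuous_const.mul (continuous_wave_left x))
    rw [norm_mul, norm_wave, mul_one]
  -- Fubini moves the test function onto the Fourier integral of `f`, which therefore vanishes
  -- almost everywhere, and everywhere by continuity. Fourier inversion then gives `f = 0`.
  have hae : ∀ᵐ ξ : Space d, ∫ x, f x * wave ξ x = 0 := by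
    refine ae_eq_zero_of_integral_contDiff_smul_eq_zero hχ.locallyIntegrable fun g hg hgs => ?_
    have hgi : Integrable fun ξ => (g ξ : ℂ) :=
      (hg.continuous.integrable_of_hasCompactSupport hgs).ofReal
    have hI : Integrable (Function.uncurry fun x ξ : Space d => f x * (wave ξ x * (g ξ : ℂ)))
        (volume.prod volume) := by
      refine ((hf.mul_prod hgi).bdd_mul (c := 1)
        (continuous_wave.comp continuous_swap).aestronglyMeasurable
        (ae_of_all _ fun p => (norm_wave p.2 p.1).le)).congr (ae_of_all _ fun p => ?_)
      simp only [Function.uncurry, Function.comp, Prod.fst_swap, Prod.snd_swap]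
      ring
    have h1 := h g hg hgs
    simp_rw [← integral_const_mul] at h1
    rw [integral_integral_swap hI] at h1
    rw [← h1]
    congr 1 with ξ
    rw [Complex.real_smul, ← integral_const_mul]
    congr 1 with x
    ring
  have hzero : (fun ξ => ∫ x, f x * wave ξ x) = fun _ => 0 :=
    Continuous.ae_eq_iff_eq volume hχ continuous_const |>.1 hae
  have hinv : 𝓕⁻ f = 0 := by
    ext ξ
    rw [Real.fourierInv_eq']
    refine Eq.trans ?_ (congrFun hzero ξ)
    congr 1 with x
    rw [wave_comm, smul_eq_mul, mul_comm]
    rfl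
  have hF : 𝓕 f = 0 := by
    ext ξ
    rw [← neg_neg ξ, ← Real.fourierInv_eq_fourier_neg, hinv]
    rfl
  have h2 := hc.fourier_fourierInv_eq hf (by rw [hF]; exact integrable_zero _ _ _)
  rw [← h2, hinv]
  ext ξ
  rw [Real.fourier_eq']
  simp

/-- The test functions with Fourier transform `exponent ^ n * h`. -/
lemma exists_schwartz_sequence {R : ℝ} (hR : ∀ᵐ y ∂r, ‖y‖ ≤ R) {h : Space d → ℝ}
    (hh : ContDiff ℝ ∞ h) (hs : HasCompactSupport h) :
    ∃ g : ℕ → 𝓢(Space d, ℂ), (∀ x, g 0 x = ∫ ξ, wave ξ x * (h ξ : ℂ)) ∧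
      (∀ n x, adjointGenerator a z μ r (g n) x = g (n + 1) x) ∧
      ∃ K M : ℝ, ∀ n x, ‖g n x‖ ≤ K * M ^ n := by
  have hψ := contDiff_exponent a z μ r hR
  have hhC : ContDiff ℝ ∞ fun ξ => (h ξ : ℂ) := Complex.ofRealCLM.contDiff.comp hh
  have hsC : HasCompactSupport fun ξ => (h ξ : ℂ) := hs.comp_left Complex.ofReal_zero
  have hcs (n : ℕ) : HasCompactSupport fun ξ => exponent a z μ r ξ ^ n * (h ξ : ℂ) :=
    hsC.mul_left
  let k (n : ℕ) : 𝓢(Space d, ℂ) := (hcs n).toSchwartzMap ((hψ.pow n).mul hhC)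
  have hk (n : ℕ) (ξ : Space d) : k n ξ = exponent a z μ r ξ ^ n * (h ξ : ℂ) := rfl
  refine ⟨fun n => 𝓕⁻ (k n), fun x => ?_, fun n x => ?_, ?_⟩
  · rw [fourierInv_apply_eq_integral_wave]
    simp [hk]
  · rw [(adjointGenerator_eq a z μ r _ x).2, FourierTransform.fourier_fourierInv_eq,
      fourierInv_apply_eq_integral_wave]
    congr 1 with ξ
    rw [hk, hk, pow_succ]
    ring
  -- The exponent is unbounded on the whole space but bounded by some `M` on the support of `h`;
  -- this is the reason for compact support in frequency.
  · obtain ⟨M, hM⟩ := hs.isCompact.exists_bound_of_continuousOn hψ.continuous.continuousOn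
    refine ⟨∫ ξ, ‖(h ξ : ℂ)‖, M, fun n x => ?_⟩
    rw [fourierInv_apply_eq_integral_wave, ← integral_mul_const]
    refine norm_integral_le_of_norm_le ?_ (ae_of_all _ fun ξ => ?_)
    · exact (hhC.continuous.integrable_of_hasCompactSupport hsC).norm.mul_const _
    · rw [norm_mul, norm_wave, one_mul, hk, norm_mul, norm_pow, mul_comm]
      by_cases hξ : ξ ∈ tsupport h
      · gcongr
        exact hM ξ hξ
      · simp [image_eq_zero_of_notMem_tsupport hξ]

variable {a z μ r}

/-- The density of a Lévy process is determined by its evolution equation. -/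
lemma IsLevyDensity.eq {R : ℝ} (hR : ∀ᵐ y ∂r, ‖y‖ ≤ R) {Φ Φ' : ℝ → Space d → ℝ}
    (hΦ : IsLevyDensity a z μ r Φ) (hΦ' : IsLevyDensity a z μ r Φ') {t : ℝ} (ht : 0 < t) :
    Φ t = Φ' t := by
  have hi := (hΦ.integrable t ht).ofReal (𝕜 := ℂ)
  have hi' := (hΦ'.integrable t ht).ofReal (𝕜 := ℂ)
  have hzero : (fun x => (Φ t x : ℂ) - (Φ' t x : ℂ)) = 0 := by
    refine eq_zero_of_integral_mul_wave_eq_zero (hi.sub hi')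
      ((Complex.continuous_ofReal.comp (hΦ.continuous t ht)).sub
        (Complex.continuous_ofReal.comp (hΦ'.continuous t ht))) fun h hh hs => ?_
    obtain ⟨g, hg0, hgA, K, M, hgb⟩ := exists_schwartz_sequence a z μ r hR hh hs
    have hbound {Ψ : ℝ → Space d → ℝ} (hΨ : IsLevyDensity a z μ r Ψ) (n : ℕ) {s : ℝ}
        (hs : 0 < s) : Integrable (fun x => (Ψ s x : ℂ) * g n x) ∧
          ‖∫ x, (Ψ s x : ℂ) * g n x‖ ≤ K * M ^ n := by
      have hI := hΨ.integrable s hs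
      refine ⟨hI.ofReal.mul_bdd (g n).continuous.aestronglyMeasurable
        (ae_of_all _ (hgb n)), ?_⟩
      calc ‖∫ x, (Ψ s x : ℂ) * g n x‖ ≤ ∫ x, Ψ s x * (K * M ^ n) := by
            refine norm_integral_le_of_norm_le (hI.mul_const _) (ae_of_all _ fun x => ?_)
            rw [norm_mul, Complex.norm_real, Real.norm_of_nonneg (hΨ.nonneg s hs x)]
            exact mul_le_mul_of_nonneg_left (hgb n x) (hΨ.nonneg s hs x)
        _ = K * M ^ n := by rw [integral_mul_const, hΨ.integral_eq_one s hs, one_mul]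
    -- The evolution equation sends the pairing with `g n` to the pairing with `g (n + 1)`. Total
    -- mass one bounds each pairing by `K * M ^ n`, hence the difference by twice that.
    have hD := eq_zero_of_hasDerivAt_succ
      (D := fun n s => (∫ x, (Φ s x : ℂ) * g n x) - ∫ x, (Φ' s x : ℂ) * g n x)
      (K := 2 * K) (M := M)
      (fun n s hs => by
        have h1 := (hΦ.equation (g n) s hs).sub (hΦ'.equation (g n) s hs)
        simp only [hgA] at h1
        exact h1)
      (fun n => by
        have := (hΦ.initial (g n)).sub (hΦ'.initial (g n))
        rwa [sub_self] at this)
      (fun n s hs => by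
        have h1 := (hbound hΦ n hs).2
        have h2 := (hbound hΦ' n hs).2
        refine (norm_sub_le _ _).trans ?_
        linarith) ht
    rw [← integral_sub (hbound hΦ 0 ht).1 (hbound hΦ' 0 ht).1] at hD
    rw [← hD]
    congr 1 with x
    rw [hg0, sub_mul]
  ext x
  have := congrFun hzero x
  simpa [sub_eq_zero] using this

end Uniqueness

/-! ### The Bessel function `J₀(2√x)` and its Laplace transform -/

section Bessel

/-- The function `J₀(2 √x)` for `x ≥ 0`. -/
noncomputable def besselKernel (x : ℝ) : ℝ :=
  Real.pi⁻¹ * ∫ θ in (0 : ℝ)..Real.pi, Real.cos (2 * √x * Real.sin θ)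

lemma continuous_besselKernel : Continuous besselKernel := by
  refine continuous_const.mul
    (intervalIntegral.continuous_parametric_intervalIntegral_of_continuous' ?_ _ _)
  simp only [Function.uncurry_def]
  fun_prop

/-- The integral representation makes visible what the alternating power series hides: boundedness
on the half-line, which lets the Laplace integral converge for every `β`. -/
lemma abs_besselKernel_le (x : ℝ) : |besselKernel x| ≤ 1 := by
  have h := intervalIntegral.norm_integral_le_of_norm_le_const (a := 0) (b := Real.pi) (C := 1)
    (f := fun θ => Real.cos (2 * √x * Real.sin θ)) fun θ _ => Real.abs_cos_le_one _
  rw [sub_zero, abs_of_pos Real.pi_pos, one_mul, Real.norm_eq_abs] at h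
  rw [besselKernel, abs_mul, abs_inv, abs_of_pos Real.pi_pos, inv_mul_le_one₀ Real.pi_pos]
  exact h

/-- This is the Wallis product in the integral of `sin ^ (2 m)`. -/
lemma prod_range_odd_div_even (m : ℕ) :
    ∏ i ∈ Finset.range m, ((2 * i + 1 : ℝ) / (2 * i + 2)) =
      (2 * m).factorial / (4 ^ m * (m.factorial : ℝ) ^ 2) := by
  induction m with
  | zero => simp
  | succ m ih =>
    rw [Finset.prod_range_succ, ih, show 2 * (m + 1) = 2 * m + 1 + 1 by ring,
      Nat.factorial_succ (2 * m + 1), Nat.factorial_succ (2 * m), Nat.factorial_succ m]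
    push_cast
    field_simp
    ring

/-- The cosine series is integrated term by term over `θ`; the Wallis integral turns its `(2m)!`
into `4 ^ m (m!)²`. -/
lemma hasSum_besselKernel {x : ℝ} (hx : 0 ≤ x) :
    HasSum (fun m : ℕ => (-x) ^ m / (m.factorial : ℝ) ^ 2) (besselKernel x) := by
  have h := intervalIntegral.hasSum_integral_of_dominated_convergence (μ := volume)
    (a := 0) (b := Real.pi)
    (F := fun (m : ℕ) θ => (-1) ^ m * (2 * √x * Real.sin θ) ^ (2 * m) / (2 * m).factorial)
    (f := fun θ => Real.cos (2 * √x * Real.sin θ))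
    (fun m _ => (2 * √x) ^ (2 * m) / (2 * m).factorial)
    (fun m => (by fun_prop : Continuous _).aestronglyMeasurable)
    (fun m => ae_of_all _ fun θ _ => ?_)
    (ae_of_all _ fun θ _ => ?_) ?_ (ae_of_all _ fun θ _ => Real.hasSum_cos _)
  · refine (h.mul_left Real.pi⁻¹).congr_fun fun m => ?_
    have e (θ : ℝ) : (-1) ^ m * (2 * √x * Real.sin θ) ^ (2 * m) / ((2 * m).factorial : ℝ) =
        ((-1) ^ m * (4 * x) ^ m / (2 * m).factorial) * Real.sin θ ^ (2 * m) := by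
      rw [mul_pow, pow_mul (2 * √x), mul_pow 2, Real.sq_sqrt hx]
      norm_num
      ring
    simp_rw [e]
    rw [intervalIntegral.integral_const_mul, integral_sin_pow_even, prod_range_odd_div_even,
      mul_pow, neg_pow x]
    have := Real.pi_ne_zero
    field_simp
  · rw [norm_div, norm_mul, norm_pow, norm_pow, norm_neg, norm_one, one_pow, one_mul, norm_mul,
      RCLike.norm_natCast, Real.norm_of_nonneg (by positivity : 0 ≤ 2 * √x)]
    refine div_le_div_of_nonneg_right (pow_le_pow_left₀ (by positivity) ?_ _) (by positivity)
    exact mul_le_of_le_one_right (by positivity) (Real.abs_sin_le_one θ)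
  · exact (Real.summable_pow_div_factorial _).comp_injective
      (mul_right_injective₀ (two_ne_zero (α := ℕ)))
  · exact intervalIntegrable_const

lemma integral_pow_mul_exp_neg_div (m : ℕ) {b : ℝ} (hb : 0 < b) :
    IntegrableOn (fun τ : ℝ => Real.exp (-(τ / b)) * τ ^ m) (Ioi 0) ∧
    ∫ τ in Ioi (0 : ℝ), Real.exp (-(τ / b)) * τ ^ m = m.factorial * b ^ (m + 1) := by
  have h := Real.integral_rpow_mul_exp_neg_mul_Ioi (a := m + 1) (r := 1 / b)
    (by positivity) (by positivity)
  have e : ∫ τ in Ioi (0 : ℝ), Real.exp (-(τ / b)) * τ ^ m = m.factorial * b ^ (m + 1) := by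
    rw [Real.Gamma_nat_eq_factorial, one_div_one_div] at h
    rw [← Real.rpow_natCast b (m + 1), mul_comm (m.factorial : ℝ)]
    push_cast
    rw [← h]
    refine setIntegral_congr_fun measurableSet_Ioi fun τ hτ => ?_
    simp only [add_sub_cancel_right, Real.rpow_natCast]
    rw [mul_comm, one_div_mul_eq_div]
  refine ⟨?_, e⟩
  -- The integral of a non-integrable function is `0` by default, so the positive value just found
  -- proves integrability.
  by_contra hc
  rw [integral_undef hc] at e
  have : 0 < m.factorial * b ^ (m + 1) := by positivity
  exact this.ne e

/-- Integrating `τ ^ m` against `exp (-τ / b)` gives `m! b ^ (m + 1)`, which cancels one of the two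
factorials and leaves an exponential series. -/
lemma integral_exp_mul_besselKernel {b c : ℝ} (hb : 0 < b) (hc : 0 ≤ c) :
    ∫ τ in Ioi (0 : ℝ), Real.exp (-(τ / b)) * besselKernel (τ * c) =
      b * Real.exp (-b * c) := by
  have hF (m : ℕ) (τ : ℝ) : Real.exp (-(τ / b)) * ((-(τ * c)) ^ m / (m.factorial : ℝ) ^ 2) =
      ((-c) ^ m / (m.factorial : ℝ) ^ 2) * (Real.exp (-(τ / b)) * τ ^ m) := by
    rw [← mul_neg, mul_pow]
    ring
  have hint (m : ℕ) : ∫ τ in Ioi (0 : ℝ),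
      Real.exp (-(τ / b)) * ((-(τ * c)) ^ m / (m.factorial : ℝ) ^ 2) =
        b * ((-b * c) ^ m / m.factorial) := by
    simp_rw [hF]
    rw [integral_const_mul, (integral_pow_mul_exp_neg_div m hb).2, neg_mul, neg_pow (b * c),
      neg_pow c, mul_pow]
    field_simp
    ring
  have hnorm (m : ℕ) : ∫ τ in Ioi (0 : ℝ),
      ‖Real.exp (-(τ / b)) * ((-(τ * c)) ^ m / (m.factorial : ℝ) ^ 2)‖ =
        b * ((b * c) ^ m / m.factorial) := by
    have : ∀ τ ∈ Ioi (0 : ℝ),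
        ‖Real.exp (-(τ / b)) * ((-(τ * c)) ^ m / (m.factorial : ℝ) ^ 2)‖ =
          (c ^ m / (m.factorial : ℝ) ^ 2) * (Real.exp (-(τ / b)) * τ ^ m) := by
      intro τ hτ
      have hτ : 0 < τ := hτ
      rw [norm_mul, norm_div, norm_pow, norm_neg, Real.norm_of_nonneg (Real.exp_pos _).le,
        Real.norm_of_nonneg (by positivity : 0 ≤ τ * c),
        Real.norm_of_nonneg (by positivity : 0 ≤ (m.factorial : ℝ) ^ 2), mul_pow]
      ring
    rw [setIntegral_congr_fun measurableSet_Ioi this, integral_const_mul,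
      (integral_pow_mul_exp_neg_div m hb).2, mul_pow]
    field_simp
    ring
  have h := hasSum_integral_of_summable_integral_norm (μ := volume.restrict (Ioi (0 : ℝ)))
    (F := fun (m : ℕ) τ => Real.exp (-(τ / b)) * ((-(τ * c)) ^ m / (m.factorial : ℝ) ^ 2))
    (fun m => by
      simp_rw [hF]
      exact (integral_pow_mul_exp_neg_div m hb).1.const_mul _)
    (by
      simp_rw [hnorm]
      exact (Real.summable_pow_div_factorial _).mul_left b)
  simp_rw [hint] at h
  have h2 : HasSum (fun m : ℕ => b * ((-b * c) ^ m / m.factorial)) (b * Real.exp (-b * c)) := by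
    have := (NormedSpace.expSeries_div_hasSum_exp (-b * c)).mul_left b
    rwa [← Real.exp_eq_exp_ℝ] at this
  rw [h2.unique h]
  refine (setIntegral_congr_fun measurableSet_Ioi fun τ hτ => ?_)
  have hτ : 0 < τ := hτ
  exact ((hasSum_besselKernel (by positivity)).mul_left _).tsum_eq.symm

end Bessel

/-! ### The Borel series as an entire function and its Laplace transform -/

section Borel

variable {d : ℕ} {r : Measure (Space d)} [IsProbabilityMeasure r] {R : ℝ}

lemma expBounded_norm_add_pow (c : Space d) (m : ℕ) :
    ExpBounded fun x : Space d => (‖c + x‖ ^ 2) ^ m := by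
  have h : ExpBounded fun x : Space d => ‖x‖ ^ 2 := by
    refine (expBounded_exp_norm (s := 2) (by norm_num)).mono
      (by fun_prop : Continuous _).stronglyMeasurable fun x => ?_
    rw [norm_pow, norm_norm, Real.norm_of_nonneg (Real.exp_pos _).le, mul_comm, Real.exp_mul,
      Real.rpow_ofNat]
    gcongr
    linarith [Real.add_one_le_exp ‖x‖]
  have := ExpBounded.prod (Finset.range m) fun _ => h.comp_add c
  simpa using this

/-- The quotient is a central binomial coefficient. Exponential moments bound `2m`-th moments by
`(2m)!`, so the double factorial in the Borel series just suffices. -/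
lemma factorial_two_mul_le (m : ℕ) : ((2 * m).factorial : ℝ) ≤ 4 ^ m * (m.factorial : ℝ) ^ 2 := by
  have h1 := Nat.choose_mul_factorial_mul_factorial (show m ≤ 2 * m by omega)
  have h2 : (2 * m).choose m ≤ 4 ^ m := by
    rw [← Nat.centralBinom_eq_two_mul_choose]
    rcases Nat.eq_zero_or_pos m with rfl | hm
    · simp
    · calc m.centralBinom = (2 * m).choose m := Nat.centralBinom_eq_two_mul_choose m
        _ ≤ 2 ^ (2 * m) := Nat.choose_le_two_pow _ _
        _ = 4 ^ m := by rw [pow_mul]; norm_num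
  rw [← h1, show 2 * m - m = m by omega]
  push_cast
  have h3 : ((2 * m).choose m : ℝ) ≤ 4 ^ m := by exact_mod_cast h2
  calc ((2 * m).choose m : ℝ) * m.factorial * m.factorial
      = (2 * m).choose m * (m.factorial : ℝ) ^ 2 := by ring
    _ ≤ _ := by gcongr

/-- The Borel transformed moments decay faster than any geometric sequence. -/
lemma exists_moment_bound (hR : ∀ᵐ y ∂r, ‖y‖ ≤ R) (l : ℝ≥0) (c : Space d) {ρ : ℝ} (hρ : 0 ≤ ρ) :
    ∃ C : ℝ, ∀ m : ℕ, ρ ^ m / (m.factorial : ℝ) ^ 2 *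
      ∫ x, (‖c + x‖ ^ 2) ^ m ∂compoundPoisson l r ≤ C * (1 / 2) ^ m := by
  -- From `u ^ (2m) ≤ (2m)! exp (s u) / s ^ (2m)` and `(2m)! ≤ 4 ^ m (m!)²` the ratio `4 ρ / s ^ 2`
  -- remains, and this `s` makes it at most `1 / 2`.
  set s : ℝ := 4 * (ρ + 1) with hs
  have hs0 : 0 < s := by positivity
  have hE : ExpBounded fun x : Space d => Real.exp (s * ‖c + x‖) :=
    (expBounded_exp_norm hs0.le).comp_add c
  refine ⟨∫ x, Real.exp (s * ‖c + x‖) ∂compoundPoisson l r, fun m => ?_⟩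
  rw [← integral_const_mul, ← integral_mul_const]
  refine integral_mono (((expBounded_norm_add_pow c m).integrable_compoundPoisson hR l).const_mul _)
    ((hE.integrable_compoundPoisson hR l).mul_const _) fun x => ?_
  have h1 := Real.pow_div_factorial_le_exp (s * ‖c + x‖) (by positivity) (2 * m)
  rw [div_le_iff₀ (by positivity)] at h1
  have h2 : ρ * 4 / s ^ 2 ≤ 1 / 2 := by
    rw [div_le_iff₀ (by positivity), hs]
    nlinarith
  have h3 : (‖c + x‖ ^ 2) ^ m = (s * ‖c + x‖) ^ (2 * m) / (s ^ 2) ^ m := by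
    rw [pow_mul, mul_pow, mul_pow]
    field_simp
  calc ρ ^ m / (m.factorial : ℝ) ^ 2 * (‖c + x‖ ^ 2) ^ m
      ≤ ρ ^ m / (m.factorial : ℝ) ^ 2 *
        (Real.exp (s * ‖c + x‖) * (4 ^ m * (m.factorial : ℝ) ^ 2) / (s ^ 2) ^ m) := by
        rw [h3]
        gcongr
        exact h1.trans (by gcongr; exact factorial_two_mul_le m)
    _ = Real.exp (s * ‖c + x‖) * (ρ * 4 / s ^ 2) ^ m := by
        rw [div_pow, mul_pow]
        field_simp
        ring
    _ ≤ Real.exp (s * ‖c + x‖) * (1 / 2) ^ m := by gcongr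

/-- For `τ ≥ 0` the Borel transformed series is an average of Bessel functions. -/
lemma hasSum_moment_besselKernel (hR : ∀ᵐ y ∂r, ‖y‖ ≤ R) (l : ℝ≥0) (c : Space d) {τ : ℝ}
    (hτ : 0 ≤ τ) :
    HasSum (fun m : ℕ => (-τ) ^ m / (m.factorial : ℝ) ^ 2 *
      ∫ x, (‖c + x‖ ^ 2) ^ m ∂compoundPoisson l r)
      (∫ x, besselKernel (τ * ‖c + x‖ ^ 2) ∂compoundPoisson l r) := by
  obtain ⟨C, hC⟩ := exists_moment_bound hR l c hτ
  have h := hasSum_integral_of_summable_integral_norm (μ := compoundPoisson l r)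
    (F := fun (m : ℕ) x => (-τ) ^ m / (m.factorial : ℝ) ^ 2 * (‖c + x‖ ^ 2) ^ m)
    (fun m => ((expBounded_norm_add_pow c m).integrable_compoundPoisson hR l).const_mul _)
    (by
      refine Summable.of_nonneg_of_le (fun m => by positivity) (fun m => ?_)
        (summable_geometric_two.mul_left C)
      refine le_trans (le_of_eq ?_) (hC m)
      rw [← integral_const_mul]
      congr 1 with x
      rw [norm_mul, norm_div, norm_pow, norm_neg, Real.norm_of_nonneg hτ,
        Real.norm_of_nonneg (by positivity : 0 ≤ (m.factorial : ℝ) ^ 2),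
        Real.norm_of_nonneg (by positivity : 0 ≤ (‖c + x‖ ^ 2) ^ m)])
  simp_rw [integral_const_mul] at h
  have e : ∫ x, besselKernel (τ * ‖c + x‖ ^ 2) ∂compoundPoisson l r =
      ∫ x, ∑' m : ℕ, (-τ) ^ m / (m.factorial : ℝ) ^ 2 * (‖c + x‖ ^ 2) ^ m
        ∂compoundPoisson l r := by
    congr 1 with x
    rw [← (hasSum_besselKernel (by positivity : 0 ≤ τ * ‖c + x‖ ^ 2)).tsum_eq]
    congr 1 with m
    rw [← neg_mul, mul_pow]
    ring
  rwa [e]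

/-- The Laplace transform of the Borel transformed series is a Gaussian average. -/
lemma integral_exp_mul_integral_besselKernel (ν : Measure (Space d)) [IsProbabilityMeasure ν]
    (c : Space d) {b : ℝ} (hb : 0 < b) :
    IntegrableOn (fun τ : ℝ => Real.exp (-(τ / b)) * ∫ x, besselKernel (τ * ‖c + x‖ ^ 2) ∂ν)
      (Ioi 0) ∧
    ∫ τ in Ioi (0 : ℝ), Real.exp (-(τ / b)) * ∫ x, besselKernel (τ * ‖c + x‖ ^ 2) ∂ν =
      b * ∫ x, Real.exp (-b * ‖c + x‖ ^ 2) ∂ν := by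
  have he : IntegrableOn (fun τ : ℝ => Real.exp (-(τ / b))) (Ioi 0) := by
    simpa using (integral_pow_mul_exp_neg_div 0 hb).1
  have hI : Integrable (Function.uncurry fun (τ : ℝ) (x : Space d) =>
      Real.exp (-(τ / b)) * besselKernel (τ * ‖c + x‖ ^ 2))
      ((volume.restrict (Ioi 0)).prod ν) := by
    refine (he.comp_fst ν).mul_bdd (c := 1) ?_ (ae_of_all _ fun p => abs_besselKernel_le _)
    exact (continuous_besselKernel.comp (by fun_prop)).aestronglyMeasurable
  simp_rw [← integral_const_mul]
  refine ⟨hI.integral_prod_left, ?_⟩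
  rw [integral_integral_swap hI]
  congr 1 with x
  exact integral_exp_mul_besselKernel hb (by positivity)

variable (a : Space d) {z t : ℝ} (φ : Space d)

lemma borelTerm_eq (hR0 : 0 ≤ R) (hR : ∀ᵐ y ∂r, ‖y‖ ≤ R) {l : ℝ≥0} (hl : (l : ℝ) = z * t)
    (τ : ℂ) (m : ℕ) :
    borelTerm a z r t φ τ m = (-τ) ^ m / ((m.factorial : ℂ) ^ 2) *
      ((∫ x, (‖t • a - φ + x‖ ^ 2) ^ m ∂compoundPoisson l r : ℝ) : ℂ) := by
  rw [borelTerm, sum_value_eq_moment hR0 hR a hl]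

lemma exists_norm_borelTerm_le (hR0 : 0 ≤ R) (hR : ∀ᵐ y ∂r, ‖y‖ ≤ R) (hzt : 0 ≤ z * t) {ρ : ℝ}
    (hρ : 0 ≤ ρ) : ∃ C : ℝ, ∀ m : ℕ, ∀ τ : ℂ, ‖τ‖ ≤ ρ →
      ‖borelTerm a z r t φ τ m‖ ≤ C * (1 / 2) ^ m := by
  obtain ⟨C, hC⟩ := exists_moment_bound hR (z * t).toNNReal (t • a - φ) hρ
  refine ⟨C, fun m τ hτ => le_trans ?_ (hC m)⟩
  have hm : 0 ≤ ∫ x, (‖t • a - φ + x‖ ^ 2) ^ m ∂compoundPoisson (z * t).toNNReal r :=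
    integral_nonneg fun x => by positivity
  rw [borelTerm_eq a φ hR0 hR (Real.coe_toNNReal _ hzt), norm_mul, norm_div, norm_pow, norm_neg,
    norm_pow, Complex.norm_natCast, Complex.norm_real, Real.norm_of_nonneg hm]
  gcongr

lemma summable_borelTerm (hR0 : 0 ≤ R) (hR : ∀ᵐ y ∂r, ‖y‖ ≤ R) (hzt : 0 ≤ z * t) (τ : ℂ) :
    Summable (borelTerm a z r t φ τ) := by
  obtain ⟨C, hC⟩ := exists_norm_borelTerm_le a φ hR0 hR hzt (norm_nonneg τ)
  exact Summable.of_norm_bounded (summable_geometric_two.mul_left C) fun m => hC m τ le_rfl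

/-- The Borel transformed series defines an entire function. -/
lemma differentiable_tsum_borelTerm (hR0 : 0 ≤ R) (hR : ∀ᵐ y ∂r, ‖y‖ ≤ R) (hzt : 0 ≤ z * t) :
    Differentiable ℂ fun τ : ℂ => ∑' m, borelTerm a z r t φ τ m := by
  intro τ₀
  obtain ⟨C, hC⟩ := exists_norm_borelTerm_le a φ hR0 hR hzt
    (by positivity : 0 ≤ ‖τ₀‖ + 1)
  have h := Complex.differentiableOn_tsum_of_summable_norm (F := fun m τ => borelTerm a z r t φ τ m)
    (U := Metric.ball 0 (‖τ₀‖ + 1)) (summable_geometric_two.mul_left C)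
    (fun m => by
      unfold borelTerm
      fun_prop)
    Metric.isOpen_ball (fun m τ hτ => hC m τ (by simpa using (Metric.mem_ball.1 hτ).le))
  refine h.differentiableAt (Metric.isOpen_ball.mem_nhds ?_)
  simp

lemma tsum_borelTerm_ofReal (hR0 : 0 ≤ R) (hR : ∀ᵐ y ∂r, ‖y‖ ≤ R) (hzt : 0 ≤ z * t) {τ : ℝ}
    (hτ : 0 ≤ τ) :
    ∑' m, borelTerm a z r t φ τ m =
      ((∫ x, besselKernel (τ * ‖t • a - φ + x‖ ^ 2) ∂compoundPoisson (z * t).toNNReal r : ℝ) :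
        ℂ) := by
  rw [← (Complex.hasSum_ofReal.2 (hasSum_moment_besselKernel hR (z * t).toNNReal (t • a - φ)
    hτ)).tsum_eq]
  congr 1 with m
  rw [borelTerm_eq a φ hR0 hR (Real.coe_toNNReal _ hzt)]
  push_cast
  rfl

lemma convex_strip (σ : ℝ) : Convex ℝ (strip σ) :=
  ((convex_Ici (0 : ℝ)).linear_image Complex.ofRealCLM.toLinearMap).thickening _

lemma ofReal_mem_strip {σ τ : ℝ} (hσ : 0 < σ) (hτ : 0 ≤ τ) : (τ : ℂ) ∈ strip σ :=
  Metric.self_subset_thickening (by positivity) _ ⟨τ, hτ, rfl⟩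

/-- The identity theorem applies: the strip is convex, hence connected, and contains `0`, near which
both functions are the sum of the series. -/
lemma IsBorelContinuation.eq_tsum {φ : Space d} {a : Space d} (hR0 : 0 ≤ R)
    (hR : ∀ᵐ y ∂r, ‖y‖ ≤ R)
    (hzt : 0 ≤ z * t) {σ : ℝ} (hσ : 0 < σ) {B : ℂ → ℂ} (hB : IsBorelContinuation a z r t φ σ B)
    {τ : ℝ} (hτ : 0 ≤ τ) : B τ = ∑' m, borelTerm a z r t φ τ m := by
  have hB0 : AnalyticOnNhd ℂ (fun τ : ℂ => ∑' m, borelTerm a z r t φ τ m) (strip σ) :=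
    fun τ _ => (differentiable_tsum_borelTerm a φ hR0 hR hzt).analyticAt τ
  refine hB.1.eqOn_of_preconnected_of_eventuallyEq hB0 (convex_strip σ).isPreconnected
    (by simpa using ofReal_mem_strip hσ le_rfl) ?_ (ofReal_mem_strip hσ hτ)
  filter_upwards [hB.2] with τ hτ using hτ.tsum_eq.symm

end Borel

end LevyBorel

/-! ### The theorem -/

open LevyBorel in
theorem corollary3p2 {d : ℕ} (a : Space d) (z : ℝ) (hz : 0 ≤ z)
    (r : Measure (Space d)) [IsProbabilityMeasure r] (hr0 : r {0} = 0)
    (hr : IsCompact r.support) :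
    (∀ μ : ℝ, 0 < μ → ∃ Φ : ℝ → Space d → ℝ, IsLevyDensity a z μ r Φ) ∧
    ∀ (t : ℝ), 0 < t → ∀ φ : Space d,
      (∃ σ : ℝ, 0 < σ ∧
        (∀ τ : ℂ, ‖τ‖ < 1 / σ → Summable (borelTerm a z r t φ τ)) ∧
        ∃ B : ℂ → ℂ, IsBorelContinuation a z r t φ σ B) ∧
      ∀ (σ : ℝ), 0 < σ → ∀ B : ℂ → ℂ, IsBorelContinuation a z r t φ σ B →
        ∀ μ : ℝ, 0 < μ → ∀ Φ : ℝ → Space d → ℝ, IsLevyDensity a z μ r Φ →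
          ∀ β : ℝ, β = 1 / (4 * μ * t) →
            IntegrableOn (fun τ : ℝ => Complex.exp (-(τ / β : ℂ)) * B τ) (Ioi 0) ∧
            (Φ t φ : ℂ) = ((Real.pi ^ (-(d : ℝ) / 2) * β ^ ((d : ℝ) / 2 - 1) : ℝ) : ℂ) *
              ∫ τ in Ioi (0 : ℝ), Complex.exp (-(τ / β : ℂ)) * B τ := by
  obtain ⟨R, hR0, hR⟩ := exists_ae_norm_le r hr
  refine ⟨fun μ hμ => ⟨_, isLevyDensity_levyDensity a r hz hμ⟩, fun t ht φ => ?_⟩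
  have hzt : 0 ≤ z * t := by positivity
  -- The sum of the series is entire, so any positive `σ` would do.
  refine ⟨⟨1, one_pos, fun τ _ => summable_borelTerm a φ hR0 hR hzt τ,
    fun τ => ∑' m, borelTerm a z r t φ τ m,
    fun τ _ => (differentiable_tsum_borelTerm a φ hR0 hR hzt).analyticAt τ,
    Eventually.of_forall fun τ => (summable_borelTerm a φ hR0 hR hzt τ).hasSum⟩, ?_⟩
  intro σ hσ B hB μ hμ Φ hΦ β hβ
  have hβ0 : 0 < β := by rw [hβ]; positivity
  obtain ⟨hi, he⟩ := integral_exp_mul_integral_besselKernel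
    (compoundPoisson (z * t).toNNReal r) (t • a - φ) hβ0
  have hBτ : ∀ τ ∈ Ioi (0 : ℝ), Complex.exp (-(τ / β : ℂ)) * B τ =
      ((Real.exp (-(τ / β)) * ∫ x, besselKernel (τ * ‖t • a - φ + x‖ ^ 2)
        ∂compoundPoisson (z * t).toNNReal r : ℝ) : ℂ) := by
    intro τ hτ
    rw [hB.eq_tsum hR0 hR hzt hσ (le_of_lt hτ), tsum_borelTerm_ofReal a φ hR0 hR hzt (le_of_lt hτ)]
    push_cast
    rfl
  refine ⟨hi.ofReal.congr ((ae_restrict_iff' measurableSet_Ioi).2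
    (ae_of_all _ fun τ hτ => (hBτ τ hτ).symm)), ?_⟩
  rw [setIntegral_congr_fun measurableSet_Ioi hBτ, integral_complex_ofReal, he,
    hΦ.eq hR (isLevyDensity_levyDensity a r hz hμ) ht, levyDensity, ← hβ, ← Complex.ofReal_mul]
  congr 1
  -- The Laplace transform supplies one factor `β`, which turns `β ^ (d/2 - 1)` into the `β ^ (d/2)`
  -- of the Gaussian normalization.
  rw [Real.div_rpow hβ0.le Real.pi_pos.le, Real.rpow_sub_one hβ0.ne', neg_div,
    Real.rpow_neg Real.pi_pos.le]
  field_simp
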